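/- **Construction.** For $k\ge 1$ let $n_k,m_k\ge 2$ be integers and let $\mathcal D_k\subseteq\{0,\dots,n_k-1\}\times\{0,\dots,m_k-1\}$ have at least two elements. For $w=(i,j)\in\mathcal D_k$ let $\Phi_w(x)=\operatorname{diag}(n_k^{-1},m_k^{-1})(x+w)$ on $\mathbb R^2$, and let $$E=\bigcap_{k\ge1}\ \bigcup_{w_1\cdots w_k\in\mathcal D_1\times\cdots\times\mathcal D_k}\Phi_{w_1}\circ\cdots\circ\Phi_{w_k}\big([0,1]^2\big)$$ be the associated self-affine Moran set. Assume $N^+=\sup_k\max\{n_k,m_k\}<\infty$. For each $k$ let $p_k$ be a probability vector on $\mathcal D_k$, and let $\mathbf p=(p_k)_{k\ge1}$. Let $\nu_{\mathbf p}=\prod_k p_k$ be the product measure on $\Sigma^\infty=\prod_{k\ge1}\mathcal D_k$, let $$\Pi(w)=\sum_{k\ge1}\operatorname{diag}\Big(\prod_{h\le k}n_h^{-1},\prod_{h\le k}m_h^{-1}\Big)w_k ,$$ so that $\Pi(\Sigma^\infty)=E$, and let $\mu_{\mathbf p}=\nu_{\mathbf p}\circ\Pi^{-1}$ be the self-affine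 Moran measure, a Borel probability measure on $E$. **Entropies.** Put $q_k(j)=\sum_{i:(i,j)\in\mathcal D_k}p_k(i,j)$ and $\widehat q_k(i)=\sum_{j:(i,j)\in\mathcal D_k}p_k(i,j)$; for $w=(i,j)$ write $q_k(w)=q_k(j)$ and $\widehat q_k(w)=\widehat q_k(i)$. For $k\ge1$ let $l=l(k)$ be the unique integer with $$\frac1{n_1\cdots n_l}\le\frac1{m_1\cdots m_k}<\frac1{n_1\cdots n_{l-1}},$$ and let (with $0\log0=0$) $$H_k(\mathbf p)=\begin{cases}-\sum_{i=1}^{l}\sum_{w\in\mathcal D_i}p_i(w)\log p_i(w)-\sum_{i=l+1}^{k}\sum_{w\in\mathcal D_i}p_i(w)\log q_i(w),& l\le k,\\[4pt]-\sum_{i=1}^{k}\sum_{w\in\mathcal D_i}p_i(w)\log p_i(w)-\sum_{i=k+1}^{l}\sum_{w\in\mathcal D_i}p_i(w)\log\widehat q_i(w),& l>k.\end{cases}$$ **Separation conditions.** $E$ satisfies the *boundary separation condition* (BSC) if there are $c_L,c_R,c_B,c_T>0$ such that $$\lim_{N\to\infty}\tfrac1N\,\#\{k\le N: i\ne0\text{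 for all }(i,j)\in\mathcal D_k\}=c_L,$$ and likewise with the condition $i\neq n_k-1$ and limit $c_R$, the condition $j\neq0$ and limit $c_B$, the condition $j\ne m_k-1$ and limit $c_T$. The measure $\mu_{\mathbf p}$ satisfies the *measure separation condition* (MSC) if there is $0<C<1$ with $$\max\{q_k(0),\,q_k(m_k-1),\,\widehat q_k(0),\,\widehat q_k(n_k-1)\}<C\quad\text{for all }k\ge1.$$ **Dimensions.** For a finite Borel measure $\mu$ on $\mathbb R^2$, $\dim_{\rm H}\mu=\inf\{\dim_{\rm H}A:\mu(A^c)=0\}$ and $\dim_{\rm P}\mu=\inf\{\dim_{\rm P}A:\mu(A^c)=0\}$, where $\dim_{\rm H}A$ and $\dim_{\rm P}A$ are the Hausdorff and packing dimensions of sets. **Theorem.** If $E$ satisfies BSC or $\mu_{\mathbf p}$ satisfies MSC, then $$\dim_{\rm H}\mu_{\mathbf p}=\liminf_{k\to\infty}\frac{H_k(\mathbf p)}{\sum_{i=1}^k\log m_i},\qquad \dim_{\rm P}\mu_{\mathbf p}=\limsup_{k\to\infty}\frac{H_k(\mathbf p)}{\sum_{i=1}^k\log m_i}.$$ -/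

import Mathlib

open Filter MeasureTheory Topology
open scoped ENNReal NNReal

noncomputable section

/-! ### Packing dimension of sets; dimensions of measures -/

section Dimension

variable {X : Type*} [PseudoMetricSpace X]

/-- A `δ`-packing of `A`: a family of pairwise disjoint closed balls with centres in `A` and radii
in `(0, δ]`. A ball is recorded as its pair (centre, radius). -/
def IsBallPacking (A : Set X) (δ : ℝ) (P : Set (X × ℝ)) : Prop :=
  (∀ b ∈ P, b.1 ∈ A ∧ 0 < b.2 ∧ b.2 ≤ δ) ∧
    P.PairwiseDisjoint (fun b => Metric.closedBall b.1 b.2)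

/-- The packing premeasure `𝒫ˢ₀(A) = lim_{δ → 0} sup {∑ |B|ˢ : δ-packings of A}`; the supremum is
monotone in `δ`, so the limit is an infimum. A ball of radius `r` has diameter `|B| = 2 r`
in `ℝᵈ`. -/
def packingPremeasure (s : ℝ≥0) (A : Set X) : ℝ≥0∞ :=
  ⨅ (δ : ℝ) (_ : 0 < δ), ⨆ (P : Set (X × ℝ)) (_ : IsBallPacking A δ P),
    ∑' b : P, ENNReal.ofReal (2 * b.1.2) ^ (s : ℝ)

/-- The `s`-dimensional packing measure
`𝒫ˢ(A) = inf {∑ᵢ 𝒫ˢ₀(Aᵢ) : A ⊆ ⋃ᵢ Aᵢ}` over countable covers. -/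
def packingMeasure (s : ℝ≥0) (A : Set X) : ℝ≥0∞ :=
  ⨅ (t : ℕ → Set X) (_ : A ⊆ ⋃ i, t i), ∑' i, packingPremeasure s (t i)

/-- The packing dimension `dim_P A = sup {s : 𝒫ˢ(A) = ∞}`. -/
def dimP (A : Set X) : ℝ≥0∞ :=
  ⨆ (s : ℝ≥0) (_ : packingMeasure s A = ∞), (s : ℝ≥0∞)

end Dimension

/-- The Hausdorff dimension of a measure, `inf {dim_H A : μ(Aᶜ) = 0}`. -/
def MeasureTheory.Measure.hausdorffDim {X : Type*} [MetricSpace X] [MeasurableSpace X]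
    (μ : Measure X) : ℝ≥0∞ :=
  ⨅ (A : Set X) (_ : μ Aᶜ = 0), dimH A

/-- The packing dimension of a measure, `inf {dim_P A : μ(Aᶜ) = 0}`. -/
def MeasureTheory.Measure.packingDim {X : Type*} [MetricSpace X] [MeasurableSpace X]
    (μ : Measure X) : ℝ≥0∞ :=
  ⨅ (A : Set X) (_ : μ Aᶜ = 0), dimP A

/-! ### Self-affine Moran sets and measures -/

/-- A self-affine Moran construction `{(n_k, m_k, 𝒟_k)}`. Levels are indexed from `0`, so index `k`
is the level `k + 1` of the usual numbering, and the first `k` levels are `Finset.range k`. -/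
structure MoranConstruction where
  /-- number of columns at each level -/
  n : ℕ → ℕ
  /-- number of rows at each level -/
  m : ℕ → ℕ
  two_le_n : ∀ k, 2 ≤ n k
  two_le_m : ∀ k, 2 ≤ m k
  /-- the digit sets, of pairs (column, row) -/
  D : ℕ → Finset (ℕ × ℕ)
  digit_lt : ∀ k, ∀ w ∈ D k, w.1 < n k ∧ w.2 < m k
  two_le_card : ∀ k, 2 ≤ (D k).card

namespace MoranConstruction

/-- The symbolic space `Σ^∞ = ∏ₖ 𝒟ₖ`. -/
abbrev Word (S : MoranConstruction) : Type := (k : ℕ) → S.D k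

/-- `N⁺ = sup {n_k, m_k}` is finite. -/
def BoundedDigits (S : MoranConstruction) : Prop :=
  BddAbove (Set.range S.n ∪ Set.range S.m)

/-- The affine map `Φ_w(x) = T_k (x + w)`, `T_k = diag(1 / n_k, 1 / m_k)`. -/
def affineMap (S : MoranConstruction) (k : ℕ) (w : S.D k)
    (x : EuclideanSpace ℝ (Fin 2)) : EuclideanSpace ℝ (Fin 2) :=
  !₂[(x 0 + (w.1.1 : ℝ)) / (S.n k : ℝ), (x 1 + (w.1.2 : ℝ)) / (S.m k : ℝ)]

/-- `Φ_{w₁} ∘ ⋯ ∘ Φ_{w_k}` for a word of length `k`. -/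
def wordMap (S : MoranConstruction) : (k : ℕ) → ((i : Fin k) → S.D i) →
    EuclideanSpace ℝ (Fin 2) → EuclideanSpace ℝ (Fin 2)
  | 0, _ => id
  | k + 1, w => S.wordMap k (fun i => w i.castSucc) ∘ S.affineMap k (w (Fin.last k))

/-- The self-affine Moran set `E = ⋂ₖ ⋃_{w ∈ Σᵏ} Φ_w([0,1]²)`. -/
def moranSet (S : MoranConstruction) : Set (EuclideanSpace ℝ (Fin 2)) :=
  ⋂ k : ℕ, ⋃ w : (i : Fin k) → S.D i, S.wordMap k w '' {x | ∀ a, x a ∈ Set.Icc (0 : ℝ) 1}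

/-- The coding map `Π : Σ^∞ → ℝ²`,
`Π(w) = ∑ₖ diag(∏_{h ≤ k} 1 / n_h, ∏_{h ≤ k} 1 / m_h) w_k`, whose range is the Moran set. -/
def proj (S : MoranConstruction) (w : S.Word) : EuclideanSpace ℝ (Fin 2) :=
  !₂[∑' k, (((w k).1.1 : ℕ) : ℝ) / ∏ h ∈ Finset.range (k + 1), (S.n h : ℝ),
    ∑' k, (((w k).1.2 : ℕ) : ℝ) / ∏ h ∈ Finset.range (k + 1), (S.m h : ℝ)]

/-- A sequence of probability vectors `p_k` on `𝒟_k`. -/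
abbrev ProbSeq (S : MoranConstruction) : Type := (k : ℕ) → PMF (S.D k)

/-- The product measure `ν_p` on `Σ^∞`: the cylinder of `w₁ ⋯ w_k` has mass `p₁(w₁) ⋯ p_k(w_k)`. -/
def symbolicMeasure (S : MoranConstruction) (p : S.ProbSeq) : Measure S.Word :=
  Measure.infinitePi (fun k => (p k).toMeasure)

/-- The self-affine Moran measure `μ_p = ν_p ∘ Π⁻¹`. -/
def moranMeasure (S : MoranConstruction) (p : S.ProbSeq) :
    Measure (EuclideanSpace ℝ (Fin 2)) :=
  (S.symbolicMeasure p).map S.proj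

/-- `p_k(w)` as a real number. -/
def prob (S : MoranConstruction) (p : S.ProbSeq) (k : ℕ) (w : S.D k) : ℝ := (p k w).toReal

/-- The row mass `q_k(j) = ∑_{(i, j) ∈ 𝒟_k} p_k(i, j)`, for fixed `j`. -/
def rowProb (S : MoranConstruction) (p : S.ProbSeq) (k j : ℕ) : ℝ :=
  ∑ w : S.D k with w.1.2 = j, S.prob p k w

/-- The column mass `q̂_k(i) = ∑_{(i, j) ∈ 𝒟_k} p_k(i, j)`, for fixed `i`. -/
def colProb (S : MoranConstruction) (p : S.ProbSeq) (k i : ℕ) : ℝ :=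
  ∑ w : S.D k with w.1.1 = i, S.prob p k w

/-- `l(k)`: the least `l` with `1 / (n₁ ⋯ n_l) ≤ 1 / (m₁ ⋯ m_k)`. -/
def ell (S : MoranConstruction) (k : ℕ) : ℕ :=
  sInf {l : ℕ | ∏ i ∈ Finset.range k, S.m i ≤ ∏ i ∈ Finset.range l, S.n i}

/-- The `k`-th entropy `H_k(p)`: the Shannon entropy of the partition of `Σ^∞` into approximate
squares of order `k`. -/
def entropy (S : MoranConstruction) (p : S.ProbSeq) (k : ℕ) : ℝ :=
  if S.ell k ≤ k then
    -((∑ i ∈ Finset.range (S.ell k), ∑ w : S.D i, S.prob p i w * Real.log (S.prob p i w)) +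
      ∑ i ∈ Finset.Ico (S.ell k) k,
        ∑ w : S.D i, S.prob p i w * Real.log (S.rowProb p i w.1.2))
  else
    -((∑ i ∈ Finset.range k, ∑ w : S.D i, S.prob p i w * Real.log (S.prob p i w)) +
      ∑ i ∈ Finset.Ico k (S.ell k),
        ∑ w : S.D i, S.prob p i w * Real.log (S.colProb p i w.1.1))

/-- `H_k(p) / ∑_{i ≤ k} log m_i`. -/
def entropyRatio (S : MoranConstruction) (p : S.ProbSeq) (k : ℕ) : ℝ :=
  S.entropy p k / ∑ i ∈ Finset.range k, Real.log (S.m i)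

end MoranConstruction

open Classical in
/-- The set of indices `k` with `Q k` has a positive natural density. -/
def HasPosDensity (Q : ℕ → Prop) : Prop :=
  ∃ c : ℝ, 0 < c ∧
    Tendsto (fun N : ℕ => (((Finset.range N).filter Q).card : ℝ) / (N : ℝ)) atTop (𝓝 c)

namespace MoranConstruction

/-- The boundary separation condition: the levels whose digit set is left empty, those where it is
right empty, bottom empty, top empty each have a positive density. -/
def BSC (S : MoranConstruction) : Prop :=
  HasPosDensity (fun k => ∀ w ∈ S.D k, w.1 ≠ 0) ∧
  HasPosDensity (fun k => ∀ w ∈ S.D k, w.1 ≠ S.n k - 1) ∧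
  HasPosDensity (fun k => ∀ w ∈ S.D k, w.2 ≠ 0) ∧
  HasPosDensity (fun k => ∀ w ∈ S.D k, w.2 ≠ S.m k - 1)

/-- The measure separation condition: the masses of the four boundary rows and columns stay below
a constant `C < 1`. -/
def MSC (S : MoranConstruction) (p : S.ProbSeq) : Prop :=
  ∃ C : ℝ, 0 < C ∧ C < 1 ∧ ∀ k,
    S.rowProb p k 0 < C ∧ S.rowProb p k (S.m k - 1) < C ∧
    S.colProb p k 0 < C ∧ S.colProb p k (S.n k - 1) < C

end MoranConstruction

end

/-! The approximate square of order `k` around a word `w` fixes the first `k` rows and the first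
`ell k` columns. By the choice of `ell k`, its image has both sides at most `1/(m₁⋯m_k) = exp
(-logHeight k)`. Its symbolic mass is `exp (-information)`, and the information is a sum of
independent digit functions with mean `entropy p k`. Their second moments are bounded uniformly,
because `x (log y)² ≤ 4` for `0 ≤ x ≤ y ≤ 1` and the digit sets have bounded size. A strong law of
large numbers then gives `information = entropy + o(k)` almost surely.

Squares are next compared with balls. A ball of radius `2 exp (-logHeight k)` contains the image of
the square, so its mass is bounded below without any separation
(`ae_eventually_le_measure_closedBall`). Conversely, a small ball around a point near the edge of
its square could collect mass from neighbouring squares. BSC or MSC excludes this for typical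
points: within `δ k` further levels there occur a digit that is not minimal and one that is not
maximal, in each coordinate, so the point lies at distance at least `exp (-logHeight k - ε k)` from
the edges (`preimage_closedBall_subset`, `ae_eventually_measure_closedBall_le`).

Since `logHeight k ≥ k log 2`, errors of size `ε k` do not affect the exponent. The lower and upper
local dimensions are therefore almost surely the liminf and limsup of `entropyRatio`, and covering
and packing arguments turn local dimensions into Hausdorff and packing dimensions of the measure. -/

/-! ### Dimensions of a measure from the decay of the mass of small balls. -/

section LocalDimension

open Metric Set

variable {X : Type*}

/-- Vitali covering lemma: a set whose points carry arbitrarily small admissible radii is covered by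
the five-fold enlargements of a countable disjoint family of admissible balls. -/
theorem exists_countable_packing_cover [PseudoMetricSpace X] [SecondCountableTopology X]
    (A : Set X) (P : X → ℝ → Prop) (hP : ∀ x ∈ A, ∃ᶠ r in 𝓝[>] (0 : ℝ), P x r)
    {δ : ℝ} (hδ : 0 < δ) :
    ∃ u : Set (X × ℝ), u.Countable ∧ IsBallPacking A δ u ∧ (∀ b ∈ u, P b.1 b.2) ∧
      A ⊆ ⋃ b ∈ u, closedBall b.1 (5 * b.2) := by
  obtain ⟨u, hut, hdisj, hcov⟩ := Vitali.exists_disjoint_subfamily_covering_enlargement_closedBall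
    {b : X × ℝ | b.1 ∈ A ∧ 0 < b.2 ∧ b.2 ≤ δ ∧ P b.1 b.2} Prod.fst Prod.snd δ
    (fun b hb => hb.2.2.1) 5 (by norm_num)
  refine ⟨u, ?_, ⟨fun b hb => ⟨(hut hb).1, (hut hb).2.1, (hut hb).2.2.1⟩, hdisj⟩,
    fun b hb => (hut hb).2.2.2, fun x hx => ?_⟩
  · refine hdisj.countable_of_nonempty_interior fun b hb => ?_
    exact (nonempty_ball.2 (hut hb).2.1).mono ball_subset_interior_closedBall
  · have h1 : ∀ᶠ r in 𝓝[>] (0 : ℝ), 0 < r ∧ r ≤ δ := Ioc_mem_nhdsGT hδ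
    obtain ⟨r, hr, h0, hd⟩ := ((hP x hx).and_eventually h1).exists
    obtain ⟨b, hb, hsub⟩ := hcov (x, r) ⟨hx, h0, hd, hr⟩
    exact mem_iUnion₂.2 ⟨b, hb, hsub (mem_closedBall_self h0.le)⟩

theorem measure_le_tsum_closedBall [PseudoMetricSpace X] [MeasurableSpace X] (μ : Measure X)
    {A : Set X} {u : Set (X × ℝ)} (hu : u.Countable) {c : ℝ}
    (h : A ⊆ ⋃ b ∈ u, closedBall b.1 (c * b.2)) :
    μ A ≤ ∑' b : u, μ (closedBall b.1.1 (c * b.1.2)) :=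
  (measure_mono h).trans (measure_biUnion_le μ hu _)

theorem tsum_measure_packing_le [PseudoMetricSpace X] [SecondCountableTopology X]
    [MeasurableSpace X] [OpensMeasurableSpace X] (μ : Measure X) {A : Set X} {δ : ℝ}
    {u : Set (X × ℝ)} (hu : IsBallPacking A δ u) :
    ∑' b : u, μ (closedBall b.1.1 b.1.2) ≤ μ univ := by
  have hc : u.Countable := hu.2.countable_of_nonempty_interior fun b hb =>
    (nonempty_ball.2 (hu.1 b hb).2.1).mono ball_subset_interior_closedBall
  rw [← measure_biUnion hc hu.2 (fun b _ => measurableSet_closedBall)]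
  exact measure_mono (subset_univ _)

/-- Countable subadditivity only, so neither `A` nor the `G n` need be measurable. This matters
because the covers defining packing measure are arbitrary. -/
theorem exists_measure_inter_ne_zero [MeasurableSpace X] (μ : Measure X) [NeZero μ] {A : Set X}
    (hA : μ Aᶜ = 0) {G : ℕ → Set X} (hG : ∀ᵐ x ∂μ, ∃ n, x ∈ G n) :
    ∃ n, μ (A ∩ G n) ≠ 0 := by
  by_contra! h
  have h1 : ∀ᵐ x ∂μ, x ∈ A := hA
  have h2 : ∀ᵐ x ∂μ, x ∉ ⋃ n, A ∩ G n := measure_eq_zero_iff_ae_notMem.1 (measure_iUnion_null h)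
  obtain ⟨x, ⟨n, hx⟩, hxA, hx2⟩ := (hG.and (h1.and h2)).exists
  exact hx2 (mem_iUnion.2 ⟨n, hxA, hx⟩)

/-- Mass distribution principle: each piece of a fine cover that meets `A` lies in a ball centred in
`A` with radius its diameter. -/
theorem le_hausdorffMeasure_of_measure_closedBall_le [MetricSpace X] [MeasurableSpace X]
    [BorelSpace X] (μ : Measure X) {s : ℝ≥0} {A : Set X} {δ : ℝ} (hδ : 0 < δ)
    (h : ∀ x ∈ A, ∀ r, 0 < r → r < δ → μ (closedBall x r) ≤ ENNReal.ofReal r ^ (s : ℝ)) :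
    μ A ≤ μH[s] A := by
  rw [Measure.hausdorffMeasure_apply]
  refine le_trans ?_ (le_iSup₂_of_le (ENNReal.ofReal (δ / 2)) (by simpa using hδ) le_rfl)
  refine le_iInf fun t => le_iInf fun ht => le_iInf fun hd => ?_
  have h1 : A ⊆ ⋃ n, A ∩ t n := by rw [← inter_iUnion]; exact subset_inter subset_rfl ht
  refine (measure_mono h1).trans ((measure_iUnion_le _).trans (ENNReal.tsum_le_tsum fun n => ?_))
  rcases (A ∩ t n).eq_empty_or_nonempty with he | ⟨x, hxA, hxt⟩
  · simp [he]
  refine le_iSup_of_le ⟨x, hxt⟩ ?_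
  have hfin : ediam (t n) ≠ ∞ := ne_top_of_le_ne_top ENNReal.ofReal_ne_top (hd n)
  have hsub : A ∩ t n ⊆ closedBall x (ediam (t n)).toReal := by
    rintro y ⟨-, hy⟩
    rw [mem_closedBall, dist_edist]
    exact ENNReal.toReal_mono hfin (edist_le_ediam_of_mem hy hxt)
  have hlt : (ediam (t n)).toReal < δ := by
    have := ENNReal.toReal_mono ENNReal.ofReal_ne_top (hd n)
    rw [ENNReal.toReal_ofReal (by positivity)] at this
    linarith
  have hlim : Tendsto (fun r : ℝ => ENNReal.ofReal r ^ (s : ℝ)) (𝓝[>] (ediam (t n)).toReal)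
      (𝓝 (ediam (t n) ^ (s : ℝ))) := by
    have : Continuous fun r : ℝ => ENNReal.ofReal r ^ (s : ℝ) :=
      ENNReal.continuous_rpow_const.comp ENNReal.continuous_ofReal
    have h2 := this.tendsto (ediam (t n)).toReal
    rw [ENNReal.ofReal_toReal hfin] at h2
    exact h2.mono_left nhdsWithin_le_nhds
  -- The diameter may be zero, where the hypothesis says nothing; radii decreasing to it are used
  -- instead.
  refine ge_of_tendsto hlim ?_
  filter_upwards [Ioo_mem_nhdsGT hlt] with r hr
  exact (measure_mono (hsub.trans (closedBall_subset_closedBall hr.1.le))).trans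
    (h x hxA r (ENNReal.toReal_nonneg.trans_lt hr.1) hr.2)

theorem le_hausdorffDim_of_ae_eventually [MetricSpace X] [MeasurableSpace X] [BorelSpace X]
    (μ : Measure X) [NeZero μ] {s : ℝ≥0}
    (h : ∀ᵐ x ∂μ, ∀ᶠ r in 𝓝[>] (0 : ℝ), μ (closedBall x r) ≤ ENNReal.ofReal r ^ (s : ℝ)) :
    (s : ℝ≥0∞) ≤ μ.hausdorffDim := by
  refine le_iInf₂ fun A hA => ?_
  -- The threshold radius depends on the point; a piece of `A` of positive measure has a uniform
  -- one.
  obtain ⟨n, hn⟩ := exists_measure_inter_ne_zero μ hA (G := fun n : ℕ =>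
    {x | ∀ r, 0 < r → r < 1 / ((n : ℝ) + 1) → μ (closedBall x r) ≤ ENNReal.ofReal r ^ (s : ℝ)}) (by
      filter_upwards [h] with x hx
      obtain ⟨δ, hδ, hx⟩ := mem_nhdsGT_iff_exists_Ioo_subset.1 hx
      obtain ⟨n, hn⟩ := exists_nat_one_div_lt (show (0 : ℝ) < δ from hδ)
      exact ⟨n, fun r h0 hr => hx ⟨h0, hr.trans hn⟩⟩)
  refine le_trans (le_dimH_of_hausdorffMeasure_ne_zero ?_)
    (dimH_mono (inter_subset_left (t := {x | ∀ r, 0 < r → r < 1 / ((n : ℝ) + 1) →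
      μ (closedBall x r) ≤ ENNReal.ofReal r ^ (s : ℝ)})))
  refine fun h0 => hn (le_antisymm ?_ bot_le)
  rw [← h0]
  exact le_hausdorffMeasure_of_measure_closedBall_le μ (δ := 1 / ((n : ℝ) + 1))
    (by positivity) (fun x hx => hx.2)

/-- The set of good points itself has finite `s`-measure: the five-fold enlargements of a fine
disjoint family cover it, and their `s`-sum is at most `10 ^ s` times the total mass. -/
theorem hausdorffDim_le_of_ae_frequently [MetricSpace X] [SecondCountableTopology X]
    [MeasurableSpace X] [BorelSpace X] (μ : Measure X) [IsFiniteMeasure μ] {s : ℝ≥0}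
    (h : ∀ᵐ x ∂μ, ∃ᶠ r in 𝓝[>] (0 : ℝ), ENNReal.ofReal r ^ (s : ℝ) ≤ μ (closedBall x r)) :
    μ.hausdorffDim ≤ s := by
  set A := {x | ∃ᶠ r in 𝓝[>] (0 : ℝ), ENNReal.ofReal r ^ (s : ℝ) ≤ μ (closedBall x r)}
  refine (iInf₂_le A h).trans (dimH_le_of_hausdorffMeasure_ne_top ?_)
  have hex : ∀ n : ℕ, ∃ u : Set (X × ℝ), u.Countable ∧ IsBallPacking A (1 / ((n : ℝ) + 1)) u ∧
      (∀ b ∈ u, ENNReal.ofReal b.2 ^ (s : ℝ) ≤ μ (closedBall b.1 b.2)) ∧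
      A ⊆ ⋃ b ∈ u, closedBall b.1 (5 * b.2) := fun n =>
    exists_countable_packing_cover A
      (fun x r => ENNReal.ofReal r ^ (s : ℝ) ≤ μ (closedBall x r)) (fun x hx => hx)
      (by positivity)
  choose u huc hup huP hcov using hex
  have := fun n => (huc n).to_subtype
  have hdiam : ∀ n, ∀ b : u n, ediam (closedBall b.1.1 (5 * b.1.2)) ≤
      ENNReal.ofReal (10 * b.1.2) := fun n b => by
    have hb := (hup n).1 b.1 b.2
    rw [← Metric.closedEBall_ofReal (by linarith)]
    refine ediam_closedEBall_le.trans ?_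
    rw [show (10 : ℝ) * b.1.2 = 2 * (5 * b.1.2) by ring, ENNReal.ofReal_mul (by norm_num)]
    simp
  have hle := Measure.hausdorffMeasure_le_liminf_tsum (ι := fun n => u n) (s : ℝ) A (l := atTop)
    (fun n : ℕ => ENNReal.ofReal (10 * (1 / ((n : ℝ) + 1))))
    (by
      have h1 := (tendsto_one_div_add_atTop_nhds_zero_nat (𝕜 := ℝ)).const_mul 10
      have h2 := (ENNReal.continuous_ofReal.tendsto _).comp h1
      rwa [mul_zero, ENNReal.ofReal_zero] at h2)
    (fun n b => closedBall b.1.1 (5 * b.1.2))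
    (Eventually.of_forall fun n b => (hdiam n b).trans (ENNReal.ofReal_le_ofReal (by
      linarith [((hup n).1 b.1 b.2).2.2])))
    (Eventually.of_forall fun n => by simpa [iUnion_subtype] using hcov n)
  refine ne_top_of_le_ne_top
    (ENNReal.mul_ne_top (ENNReal.rpow_ne_top_of_nonneg s.coe_nonneg (ENNReal.ofReal_ne_top (r := 10)))
      (measure_ne_top μ univ)) (hle.trans ?_)
  refine liminf_le_of_le (by isBoundedDefault) fun c hc => ?_
  obtain ⟨n, hn⟩ := hc.exists
  refine hn.trans (le_trans ?_ (mul_le_mul_right (tsum_measure_packing_le μ (hup n)) _))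
  rw [← ENNReal.tsum_mul_left]
  refine ENNReal.tsum_le_tsum fun b => (ENNReal.rpow_le_rpow (hdiam n b) s.coe_nonneg).trans ?_
  rw [ENNReal.ofReal_mul (by norm_num), ENNReal.mul_rpow_of_nonneg _ _ s.coe_nonneg]
  exact mul_le_mul_right (huP n b.1 b.2) _

theorem packingMeasure_eq_zero_of_forall [PseudoMetricSpace X] {s : ℝ≥0} {A : Set X}
    {t : ℕ → Set X} (hA : A ⊆ ⋃ i, t i) (ht : ∀ i, packingPremeasure s (t i) = 0) :
    packingMeasure s A = 0 :=
  le_antisymm ((iInf₂_le t hA).trans (by simp [ht])) bot_le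

theorem tendsto_ofReal_mul_rpow_zero {c t : ℝ} (ht : 0 < t) :
    Tendsto (fun δ : ℝ => ENNReal.ofReal (c * δ) ^ t) (𝓝[>] 0) (𝓝 0) := by
  have : Continuous fun δ : ℝ => ENNReal.ofReal (c * δ) ^ t :=
    ENNReal.continuous_rpow_const.comp (ENNReal.continuous_ofReal.comp (continuous_const_mul c))
  have h := this.tendsto 0
  simp only [mul_zero, ENNReal.ofReal_zero, ENNReal.zero_rpow_of_pos ht] at h
  exact h.mono_left nhdsWithin_le_nhds

/-- In a packing of mesh `η` the `s`-sum is bounded by the total mass, and the surplus exponent `t -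
s` contributes a factor that vanishes with `η`. -/
theorem packingPremeasure_eq_zero_of_le_measure [PseudoMetricSpace X] [SecondCountableTopology X]
    [MeasurableSpace X] [OpensMeasurableSpace X] (μ : Measure X) [IsFiniteMeasure μ] {s t : ℝ≥0}
    (hst : s < t) {A : Set X} {δ : ℝ} (hδ : 0 < δ)
    (h : ∀ x ∈ A, ∀ r, 0 < r → r < δ → ENNReal.ofReal r ^ (s : ℝ) ≤ μ (closedBall x r)) :
    packingPremeasure t A = 0 := by
  have key : ∀ η ∈ Ioo 0 δ, packingPremeasure t A ≤
      ENNReal.ofReal (2 * η) ^ ((t : ℝ) - s) * (ENNReal.ofReal 2 ^ (s : ℝ) * μ univ) := by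
    rintro η ⟨h0, hη⟩
    refine (iInf₂_le η h0).trans (iSup₂_le fun P hP => ?_)
    refine le_trans ?_ (mul_le_mul_right (mul_le_mul_right (tsum_measure_packing_le μ hP) _) _)
    rw [← ENNReal.tsum_mul_left, ← ENNReal.tsum_mul_left]
    refine ENNReal.tsum_le_tsum fun b => ?_
    obtain ⟨hbA, hb0, hbη⟩ := hP.1 b.1 b.2
    have hpos : ENNReal.ofReal (2 * b.1.2) ≠ 0 := by simpa using hb0
    have ht : 0 ≤ (t : ℝ) - s := sub_nonneg.2 (NNReal.coe_le_coe.2 hst.le)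
    calc ENNReal.ofReal (2 * b.1.2) ^ (t : ℝ)
        = ENNReal.ofReal (2 * b.1.2) ^ ((t : ℝ) - s) * ENNReal.ofReal (2 * b.1.2) ^ (s : ℝ) := by
          rw [← ENNReal.rpow_add _ _ hpos ENNReal.ofReal_ne_top, sub_add_cancel]
      _ ≤ _ := by
          gcongr
          rw [ENNReal.ofReal_mul (by norm_num), ENNReal.mul_rpow_of_nonneg _ _ s.coe_nonneg]
          gcongr
          exact h _ hbA _ hb0 (hbη.trans_lt hη)
  have hlim := ENNReal.Tendsto.mul_const (b := ENNReal.ofReal 2 ^ (s : ℝ) * μ univ)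
    (tendsto_ofReal_mul_rpow_zero (c := 2) (sub_pos.2 (NNReal.coe_lt_coe.2 hst)))
    (Or.inr (ENNReal.mul_ne_top (ENNReal.rpow_ne_top_of_nonneg s.coe_nonneg ENNReal.ofReal_ne_top)
      (measure_ne_top μ univ)))
  rw [zero_mul] at hlim
  exact le_antisymm (ge_of_tendsto hlim (mem_of_superset (Ioo_mem_nhdsGT hδ) key)) bot_le

theorem packingDim_le_of_ae_eventually [MetricSpace X] [SecondCountableTopology X]
    [MeasurableSpace X] [BorelSpace X] (μ : Measure X) [IsFiniteMeasure μ] {s : ℝ≥0}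
    (h : ∀ᵐ x ∂μ, ∀ᶠ r in 𝓝[>] (0 : ℝ), ENNReal.ofReal r ^ (s : ℝ) ≤ μ (closedBall x r)) :
    μ.packingDim ≤ s := by
  refine (iInf₂_le {x | ∀ᶠ r in 𝓝[>] (0 : ℝ), ENNReal.ofReal r ^ (s : ℝ) ≤ μ (closedBall x r)}
    h).trans (iSup₂_le fun t ht => ?_)
  by_contra! hst
  have hst' : s < t := by exact_mod_cast hst
  refine ENNReal.zero_ne_top ((packingMeasure_eq_zero_of_forall (t := fun n : ℕ =>
    {x | ∀ r, 0 < r → r < 1 / ((n : ℝ) + 1) → ENNReal.ofReal r ^ (s : ℝ) ≤ μ (closedBall x r)})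
    ?_ fun n => packingPremeasure_eq_zero_of_le_measure μ hst'
      (δ := 1 / ((n : ℝ) + 1)) (by positivity) fun x hx => hx).symm.trans ht)
  intro x hx
  obtain ⟨δ, hδ, hx⟩ := mem_nhdsGT_iff_exists_Ioo_subset.1 hx
  obtain ⟨n, hn⟩ := exists_nat_one_div_lt (show (0 : ℝ) < δ from hδ)
  exact mem_iUnion.2 ⟨n, fun r h0 hr => hx ⟨h0, hr.trans hn⟩⟩

/-- If packing sums were bounded by `T`, enlarging Vitali packings of mesh `η` to covers would bound
`μ A` by a constant times `η ^ (t - s) * T`, which tends to zero. -/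
theorem packingPremeasure_eq_top_of_measure_le [PseudoMetricSpace X] [SecondCountableTopology X]
    [MeasurableSpace X] (μ : Measure X) {s t : ℝ≥0} (hst : s < t) {A : Set X} (hA : μ A ≠ 0)
    (h : ∀ x ∈ A, ∃ᶠ r in 𝓝[>] (0 : ℝ), μ (closedBall x r) ≤ ENNReal.ofReal r ^ (t : ℝ)) :
    packingPremeasure s A = ∞ := by
  -- The smallness is imposed on the enlarged ball, since the enlargements are what covers `A`.
  have h5 : ∀ x ∈ A, ∃ᶠ r in 𝓝[>] (0 : ℝ),
      μ (closedBall x (5 * r)) ≤ ENNReal.ofReal (5 * r) ^ (t : ℝ) := fun x hx => by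
    have hlim : Tendsto (fun r : ℝ => r / 5) (𝓝[>] 0) (𝓝[>] 0) := by
      refine tendsto_nhdsWithin_iff.2 ⟨?_, ?_⟩
      · have h0 := (continuous_id.div_const (5 : ℝ)).tendsto 0
        simp only [id, zero_div] at h0
        exact h0.mono_left nhdsWithin_le_nhds
      · filter_upwards [self_mem_nhdsWithin] with r hr
        exact div_pos (mem_Ioi.1 hr) (by norm_num : (0 : ℝ) < 5)
    refine hlim.frequently ((h x hx).mono fun r hr => ?_)
    rwa [mul_div_cancel₀ _ (by norm_num : (5 : ℝ) ≠ 0)]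
  refine iInf₂_eq_top.2 fun δ hδ => ?_
  by_contra hfin
  set T := ⨆ (P : Set (X × ℝ)) (_ : IsBallPacking A δ P),
    ∑' b : P, ENNReal.ofReal (2 * b.1.2) ^ (s : ℝ) with hT
  have key : ∀ η ∈ Ioo 0 δ, μ A ≤
      ENNReal.ofReal (5 * η) ^ ((t : ℝ) - s) * (ENNReal.ofReal (5 / 2) ^ (s : ℝ) * T) := by
    rintro η ⟨h0, hη⟩
    obtain ⟨u, huc, hup, huP, hcov⟩ := exists_countable_packing_cover A _ h5 h0
    have hup' : IsBallPacking A δ u :=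
      ⟨fun b hb => ⟨(hup.1 b hb).1, (hup.1 b hb).2.1, (hup.1 b hb).2.2.trans hη.le⟩, hup.2⟩
    have hle : ∑' b : u, ENNReal.ofReal (2 * b.1.2) ^ (s : ℝ) ≤ T :=
      le_iSup₂_of_le u hup' le_rfl
    refine (measure_le_tsum_closedBall μ huc hcov).trans
      (le_trans ?_ (mul_le_mul_right (mul_le_mul_right hle _) _))
    rw [← ENNReal.tsum_mul_left, ← ENNReal.tsum_mul_left]
    refine ENNReal.tsum_le_tsum fun b => (huP b.1 b.2).trans ?_
    obtain ⟨-, hb0, hbη⟩ := hup.1 b.1 b.2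
    have hpos : ENNReal.ofReal (5 * b.1.2) ≠ 0 := by simpa using hb0
    have ht : 0 ≤ (t : ℝ) - s := sub_nonneg.2 (NNReal.coe_le_coe.2 hst.le)
    calc ENNReal.ofReal (5 * b.1.2) ^ (t : ℝ)
        = ENNReal.ofReal (5 * b.1.2) ^ ((t : ℝ) - s) * ENNReal.ofReal (5 * b.1.2) ^ (s : ℝ) := by
          rw [← ENNReal.rpow_add _ _ hpos ENNReal.ofReal_ne_top, sub_add_cancel]
      _ ≤ _ := by
          gcongr
          rw [← ENNReal.mul_rpow_of_nonneg _ _ s.coe_nonneg, ← ENNReal.ofReal_mul (by norm_num)]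
          exact le_of_eq (by ring_nf)
  have hlim := ENNReal.Tendsto.mul_const (b := ENNReal.ofReal (5 / 2) ^ (s : ℝ) * T)
    (tendsto_ofReal_mul_rpow_zero (c := 5) (sub_pos.2 (NNReal.coe_lt_coe.2 hst)))
    (Or.inr (ENNReal.mul_ne_top (ENNReal.rpow_ne_top_of_nonneg s.coe_nonneg ENNReal.ofReal_ne_top) hfin))
  rw [zero_mul] at hlim
  exact hA (le_antisymm (ge_of_tendsto hlim (mem_of_superset (Ioo_mem_nhdsGT hδ) key)) bot_le)

theorem packingPremeasure_mono [PseudoMetricSpace X] (s : ℝ≥0) {A B : Set X} (h : A ⊆ B) :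
    packingPremeasure s A ≤ packingPremeasure s B :=
  iInf₂_mono fun _ _ => iSup_mono fun _ => iSup_mono' fun hP =>
    ⟨⟨fun b hb => ⟨h (hP.1 b hb).1, (hP.1 b hb).2⟩, hP.2⟩, le_rfl⟩

theorem le_packingDim_of_ae_frequently [MetricSpace X] [SecondCountableTopology X]
    [MeasurableSpace X] (μ : Measure X) [NeZero μ] {t : ℝ≥0}
    (h : ∀ᵐ x ∂μ, ∃ᶠ r in 𝓝[>] (0 : ℝ), μ (closedBall x r) ≤ ENNReal.ofReal r ^ (t : ℝ)) :
    (t : ℝ≥0∞) ≤ μ.packingDim := by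
  refine le_iInf₂ fun A hA => le_of_forall_lt_imp_le_of_dense fun a ha => ?_
  lift a to ℝ≥0 using ha.ne_top
  refine le_iSup₂_of_le a ?_ le_rfl
  refine iInf₂_eq_top.2 fun E hE => ?_
  have hAE : ∀ᵐ x ∂μ, x ∈ A := hA
  obtain ⟨n, hn⟩ := exists_measure_inter_ne_zero μ h (G := E)
    (by filter_upwards [hAE] with x hx using mem_iUnion.1 (hE hx))
  refine ENNReal.tsum_eq_top_of_eq_top ⟨n, top_le_iff.1 ?_⟩
  rw [← packingPremeasure_eq_top_of_measure_le μ (by exact_mod_cast ha) hn fun x hx => hx.1]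
  exact packingPremeasure_mono a inter_subset_right

end LocalDimension

/-! ### A strong law for independent nonnegative variables with bounded second moments. -/

section LawOfLargeNumbers

open ProbabilityTheory

/-- Between consecutive squares `S` is trapped by monotonicity, while `e` grows by at most `|W| (2k
+ 1)`, which is negligible against `k²`. -/
theorem eventually_abs_sub_le_of_squares {S e : ℕ → ℝ} (hS : Monotone S) {W : ℝ}
    (hW : ∀ i j, i ≤ j → e j - e i ≤ W * ((j : ℝ) - i)) {ε : ℝ} (hε : 0 < ε)
    (h : ∀ᶠ k : ℕ in atTop, |S (k ^ 2) - e (k ^ 2)| ≤ ε / 8 * (k : ℝ) ^ 2) :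
    ∀ᶠ n : ℕ in atTop, |S n - e n| ≤ ε * n := by
  obtain ⟨K, hK⟩ := eventually_atTop.1 h
  -- Gives `k ≥ 1` and `6|W| ≤ ε k`, hence `|W| (2k + 1) ≤ 3|W| k ≤ (ε / 2) k²`.
  obtain ⟨J, hJ⟩ := exists_nat_ge (6 * |W| / ε + 1)
  refine eventually_atTop.2 ⟨(K + J) ^ 2, fun n hn => ?_⟩
  set k := n.sqrt with hk
  have hkn : k ^ 2 ≤ n := Nat.sqrt_le' n
  have hnk : n < (k + 1) ^ 2 := Nat.lt_succ_sqrt' n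
  have hKk : K + J ≤ k := Nat.le_sqrt'.2 hn
  have h1 := abs_le.1 (hK k (by omega))
  have h2 := abs_le.1 (hK (k + 1) (by omega))
  have hkJ : 6 * |W| / ε + 1 ≤ (k : ℝ) := hJ.trans (by exact_mod_cast (by omega : J ≤ k))
  have hk1 : (1 : ℝ) ≤ k := by
    have : 0 ≤ 6 * |W| / ε := by positivity
    linarith
  have hkW : 6 * |W| ≤ ε * k := by
    have h3 : 6 * |W| / ε ≤ k := by linarith
    rwa [div_le_iff₀ hε, mul_comm (k : ℝ)] at h3
  have hn1 : (k : ℝ) ^ 2 ≤ n := by exact_mod_cast hkn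
  have hn2 : (n : ℝ) ≤ ((k : ℝ) + 1) ^ 2 := by exact_mod_cast hnk.le
  have e1 := hW (k ^ 2) n hkn
  have e2 := hW n ((k + 1) ^ 2) hnk.le
  have s1 := hS hkn
  have s2 := hS hnk.le
  push_cast at e1 e2 h2 h1
  have hWk : |W| * (2 * k + 1) ≤ ε / 2 * (k : ℝ) ^ 2 := by nlinarith [abs_nonneg W]
  have hw1 : W * (n - (k : ℝ) ^ 2) ≤ |W| * (2 * k + 1) :=
    mul_le_mul (le_abs_self W) (by linarith) (by linarith) (abs_nonneg W)
  have hw2 : W * (((k : ℝ) + 1) ^ 2 - n) ≤ |W| * (2 * k + 1) :=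
    mul_le_mul (le_abs_self W) (by linarith) (by linarith) (abs_nonneg W)
  have hsq : ε / 8 * ((k : ℝ) + 1) ^ 2 ≤ ε / 2 * (k : ℝ) ^ 2 := by
    have : ((k : ℝ) + 1) ^ 2 ≤ 4 * (k : ℝ) ^ 2 := by nlinarith
    nlinarith
  have hfin : ε * (k : ℝ) ^ 2 ≤ ε * n := mul_le_mul_of_nonneg_left hn1 hε.le
  have hpos : 0 ≤ ε * (k : ℝ) ^ 2 := by positivity
  exact abs_le.2 ⟨by linarith, by linarith⟩

theorem ae_eventually_abs_sum_sub_le {Ω : Type*} [MeasurableSpace Ω] {P : Measure Ω}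
    [IsProbabilityMeasure P] {X : ℕ → Ω → ℝ} (h0 : ∀ i ω, 0 ≤ X i ω)
    (hL : ∀ i, MemLp (X i) 2 P) (hind : Pairwise fun i j => IndepFun (X i) (X j) P) {V : ℝ}
    (hV : ∀ i, ∫ ω, X i ω ^ 2 ∂P ≤ V) {ε : ℝ} (hε : 0 < ε) :
    ∀ᵐ ω ∂P, ∀ᶠ n : ℕ in atTop,
      |∑ i ∈ Finset.range n, X i ω - ∑ i ∈ Finset.range n, ∫ ω, X i ω ∂P| ≤ ε * n := by
  have hint : ∀ i, Integrable (X i) P := fun i => (hL i).integrable (by norm_num)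
  have hV0 : 0 ≤ V := (integral_nonneg fun ω => sq_nonneg (X 0 ω)).trans (hV 0)
  have hvar : ∀ i, variance (X i) P ≤ V := fun i =>
    (variance_le_expectation_sq (hL i).1).trans (hV i)
  have hmean : ∀ i, ∫ ω, X i ω ∂P ≤ 1 + V := fun i => by
    calc ∫ ω, X i ω ∂P ≤ ∫ ω, (1 + X i ω ^ 2) ∂P :=
          integral_mono (hint i) ((integrable_const _).add (hL i).integrable_sq)
            fun ω => by nlinarith [sq_nonneg (X i ω - 1), sq_nonneg (X i ω)]
      _ = 1 + ∫ ω, X i ω ^ 2 ∂P := by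
          rw [integral_add (integrable_const _) (hL i).integrable_sq]; simp
      _ ≤ 1 + V := by linarith [hV i]
  have hSL : ∀ n, MemLp (∑ i ∈ Finset.range n, X i) 2 P := fun n =>
    memLp_finsetSum' _ fun i _ => hL i
  have hSvar : ∀ n, variance (∑ i ∈ Finset.range n, X i) P ≤ n * V := fun n => by
    rw [IndepFun.variance_sum (fun i _ => hL i) fun i _ j _ hij => hind hij]
    exact (Finset.sum_le_sum fun i _ => hvar i).trans (by simp)
  have hSmean : ∀ n, ∫ ω, (∑ i ∈ Finset.range n, X i) ω ∂P =
      ∑ i ∈ Finset.range n, ∫ ω, X i ω ∂P := fun n => by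
    simp_rw [Finset.sum_apply]
    exact integral_finsetSum _ fun i _ => hint i
  set B : ℕ → Set Ω := fun k => {ω | ε / 8 * ((k : ℝ) + 1) ^ 2 ≤
    |(∑ i ∈ Finset.range ((k + 1) ^ 2), X i) ω -
      ∫ ω, (∑ i ∈ Finset.range ((k + 1) ^ 2), X i) ω ∂P|} with hB
  -- Chebyshev at time `(k + 1)²`: the variance is linear in time and the squared deviation
  -- quadratic, so the bounds are summable along squares.
  have hBle : ∀ k, P (B k) ≤ ENNReal.ofReal (64 * V / ε ^ 2 * (1 / ((k : ℝ) + 1) ^ 2)) := fun k => by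
    refine (meas_ge_le_variance_div_sq (hSL _) (by positivity)).trans (ENNReal.ofReal_le_ofReal ?_)
    have h1 := hSvar ((k + 1) ^ 2)
    push_cast at h1
    calc _ ≤ ((k : ℝ) + 1) ^ 2 * V / (ε / 8 * ((k : ℝ) + 1) ^ 2) ^ 2 := by gcongr
      _ = _ := by field_simp; ring
  have hsum : Summable fun k : ℕ => 64 * V / ε ^ 2 * (1 / ((k : ℝ) + 1) ^ 2) := by
    refine Summable.mul_left _ ?_
    have := (summable_nat_add_iff 1).2 (Real.summable_one_div_nat_pow.2 (one_lt_two))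
    simpa using this
  have hBC : ∑' k, P (B k) ≠ ∞ :=
    ne_top_of_le_ne_top hsum.tsum_ofReal_ne_top (ENNReal.tsum_le_tsum hBle)
  filter_upwards [ae_eventually_notMem hBC] with ω hω
  refine eventually_abs_sub_le_of_squares (W := 1 + V) ?_ ?_ hε ?_
  · exact monotone_nat_of_le_succ fun n => by
      rw [Finset.sum_range_succ]; linarith [h0 n ω]
  · intro i j hij
    rw [← Finset.sum_Ico_eq_sub _ hij]
    refine (Finset.sum_le_sum fun i _ => hmean i).trans ?_
    rw [Finset.sum_const, Nat.card_Ico, nsmul_eq_mul, Nat.cast_sub hij, mul_comm]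
  · refine (eventually_atTop.2 ?_)
    obtain ⟨K, hK⟩ := eventually_atTop.1 hω
    refine ⟨K + 1, fun k hk => ?_⟩
    obtain ⟨k, rfl⟩ : ∃ j, k = j + 1 := ⟨k - 1, by omega⟩
    have h1 := hK k (by omega)
    simp only [hB, Set.mem_ofPred_eq, not_le] at h1
    rw [hSmean, Finset.sum_apply] at h1
    push_cast
    exact h1.le

end LawOfLargeNumbers

/-! ### Mixed radix expansions and the distance between numbers with different leading digits. -/

section MixedRadix

/-- `b₀ ⋯ b_{n-1}`, the denominator of the `n`-th digit of a mixed radix expansion. -/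
noncomputable def radixProd (b : ℕ → ℕ) (n : ℕ) : ℝ := ∏ h ∈ Finset.range n, (b h : ℝ)

/-- The value of the digits from the `n`-th on in a mixed radix expansion. -/
noncomputable def radixTail (b : ℕ → ℕ) (n : ℕ) (d : ℕ → ℕ) : ℝ :=
  ∑' k, (d (k + n) : ℝ) / radixProd b (k + n + 1)

variable {b : ℕ → ℕ}

theorem radixProd_succ (b : ℕ → ℕ) (n : ℕ) : radixProd b (n + 1) = radixProd b n * b n :=
  Finset.prod_range_succ _ _

theorem two_pow_le_radixProd (hb : ∀ k, 2 ≤ b k) (n : ℕ) : (2 : ℝ) ^ n ≤ radixProd b n := by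
  calc (2 : ℝ) ^ n = ∏ _h ∈ Finset.range n, (2 : ℝ) := by simp
    _ ≤ _ := Finset.prod_le_prod (fun _ _ => by norm_num) fun h _ => by exact_mod_cast hb h

theorem radixProd_pos (hb : ∀ k, 2 ≤ b k) (n : ℕ) : 0 < radixProd b n :=
  (by positivity : (0 : ℝ) < 2 ^ n).trans_le (two_pow_le_radixProd hb n)

theorem radixProd_mono (hb : ∀ k, 2 ≤ b k) : Monotone (radixProd b) :=
  monotone_nat_of_le_succ fun n => by
    rw [radixProd_succ]
    exact le_mul_of_one_le_right (radixProd_pos hb n).le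
      (by exact_mod_cast (one_le_two.trans (hb n)))

theorem tendsto_inv_radixProd (hb : ∀ k, 2 ≤ b k) :
    Tendsto (fun n => 1 / radixProd b n) atTop (𝓝 0) := by
  simp_rw [one_div]
  exact (tendsto_atTop_mono (two_pow_le_radixProd hb)
    (tendsto_pow_atTop_atTop_of_one_lt one_lt_two)).inv_tendsto_atTop

/-- The series telescopes, because `(b - 1)/(B b) = 1/B - 1/(B b)`. -/
theorem hasSum_maximal_digits (hb : ∀ k, 2 ≤ b k) (n : ℕ) :
    HasSum (fun k => ((b (k + n) : ℝ) - 1) / radixProd b (k + n + 1)) (1 / radixProd b n) := by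
  have hterm : ∀ k, ((b (k + n) : ℝ) - 1) / radixProd b (k + n + 1) =
      1 / radixProd b (k + n) - 1 / radixProd b (k + 1 + n) := fun k => by
    have h1 := (radixProd_pos hb (k + n)).ne'
    have h2 : (b (k + n) : ℝ) ≠ 0 := by have := hb (k + n); positivity
    rw [add_right_comm k 1 n, radixProd_succ]
    field_simp
  rw [hasSum_iff_tendsto_nat_of_nonneg]
  · simp_rw [hterm, Finset.sum_range_sub' (fun k => 1 / radixProd b (k + n)), zero_add]
    simpa using ((tendsto_add_atTop_iff_nat n).2 (tendsto_inv_radixProd hb)).const_sub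
      (1 / radixProd b n)
  · intro k
    have : (2 : ℝ) ≤ b (k + n) := by exact_mod_cast hb (k + n)
    exact div_nonneg (by linarith) (radixProd_pos hb _).le

theorem digit_le_sub_one {d : ℕ → ℕ} (hd : ∀ k, d k < b k) (k : ℕ) : (d k : ℝ) ≤ b k - 1 := by
  have : (d k : ℝ) + 1 ≤ b k := by exact_mod_cast hd k
  linarith

theorem digit_div_le (hb : ∀ k, 2 ≤ b k) {d : ℕ → ℕ} (hd : ∀ k, d k < b k) (n k : ℕ) :
    (d (k + n) : ℝ) / radixProd b (k + n + 1) ≤ ((b (k + n) : ℝ) - 1) / radixProd b (k + n + 1) :=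
  div_le_div_of_nonneg_right (digit_le_sub_one hd _) (radixProd_pos hb _).le

theorem digit_div_nonneg (hb : ∀ k, 2 ≤ b k) (d : ℕ → ℕ) (n k : ℕ) :
    0 ≤ (d (k + n) : ℝ) / radixProd b (k + n + 1) :=
  div_nonneg (Nat.cast_nonneg _) (radixProd_pos hb _).le

theorem summable_digits (hb : ∀ k, 2 ≤ b k) {d : ℕ → ℕ} (hd : ∀ k, d k < b k) (n : ℕ) :
    Summable fun k => (d (k + n) : ℝ) / radixProd b (k + n + 1) :=
  .of_nonneg_of_le (digit_div_nonneg hb d n) (digit_div_le hb hd n)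
    (hasSum_maximal_digits hb n).summable

theorem radixTail_nonneg (hb : ∀ k, 2 ≤ b k) (n : ℕ) (d : ℕ → ℕ) : 0 ≤ radixTail b n d :=
  tsum_nonneg (digit_div_nonneg hb d n)

theorem radixTail_le (hb : ∀ k, 2 ≤ b k) {d : ℕ → ℕ} (hd : ∀ k, d k < b k) (n : ℕ) :
    radixTail b n d ≤ 1 / radixProd b n := by
  rw [← (hasSum_maximal_digits hb n).tsum_eq]
  exact (summable_digits hb hd n).tsum_le_tsum (digit_div_le hb hd n)
    (hasSum_maximal_digits hb n).summable

theorem one_div_le_radixTail (hb : ∀ k, 2 ≤ b k) {d : ℕ → ℕ} (hd : ∀ k, d k < b k) {n h : ℕ}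
    (hn : n ≤ h) (h0 : d h ≠ 0) : 1 / radixProd b (h + 1) ≤ radixTail b n d := by
  have h1 := (summable_digits hb hd n).le_tsum (h - n) fun k _ => digit_div_nonneg hb d n k
  rw [Nat.sub_add_cancel hn] at h1
  refine le_trans ?_ h1
  have : (1 : ℝ) ≤ d h := by exact_mod_cast Nat.one_le_iff_ne_zero.2 h0
  exact div_le_div_of_nonneg_right this (radixProd_pos hb _).le

theorem radixTail_le_sub (hb : ∀ k, 2 ≤ b k) {d : ℕ → ℕ} (hd : ∀ k, d k < b k) {n h : ℕ}
    (hn : n ≤ h) (h0 : d h ≠ b h - 1) :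
    radixTail b n d ≤ 1 / radixProd b n - 1 / radixProd b (h + 1) := by
  have hs := (hasSum_maximal_digits hb n).summable.sub (summable_digits hb hd n)
  have h1 := hs.le_tsum (h - n) fun k _ => sub_nonneg.2 (digit_div_le hb hd n k)
  rw [Nat.sub_add_cancel hn, (hasSum_maximal_digits hb n).summable.tsum_sub
    (summable_digits hb hd n), (hasSum_maximal_digits hb n).tsum_eq, ← sub_div] at h1
  have h2 : (1 : ℝ) ≤ b h - 1 - d h := by
    have : d h + 2 ≤ b h := by have := hd h; omega
    have : (d h : ℝ) + 2 ≤ b h := by exact_mod_cast this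
    linarith
  have h3 := div_le_div_of_nonneg_right h2 (radixProd_pos hb (h + 1)).le
  change _ ≤ 1 / radixProd b n - radixTail b n d at h1
  linarith

theorem radixTail_zero_eq (hb : ∀ k, 2 ≤ b k) {d : ℕ → ℕ} (hd : ∀ k, d k < b k) (n : ℕ) :
    radixTail b 0 d = ∑ k ∈ Finset.range n, (d k : ℝ) / radixProd b (k + 1) + radixTail b n d :=
  ((summable_digits hb hd 0).sum_add_tsum_nat_add n).symm

theorem abs_radixTail_sub_le (hb : ∀ k, 2 ≤ b k) {d d' : ℕ → ℕ} (hd : ∀ k, d k < b k)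
    (hd' : ∀ k, d' k < b k) {n : ℕ} (h : ∀ i < n, d i = d' i) :
    |radixTail b 0 d - radixTail b 0 d'| ≤ 1 / radixProd b n := by
  rw [radixTail_zero_eq hb hd n, radixTail_zero_eq hb hd' n,
    Finset.sum_congr rfl fun i hi => by rw [h i (Finset.mem_range.1 hi)], add_sub_add_left_eq_sub]
  have h1 := radixTail_nonneg hb n d
  have h2 := radixTail_nonneg hb n d'
  have h3 := radixTail_le hb hd n
  have h4 := radixTail_le hb hd' n
  exact abs_le.2 ⟨by linarith, by linarith⟩

/-- At the first disagreement the leading parts differ by at least one unit, which opposite extreme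
tails could cancel. A non-maximal digit of `d` prevents this when `d` is the smaller number, a
non-minimal one when it is the larger. Nothing is required of `d'`, which suits a typical centre and
an arbitrary other point of the ball. -/
theorem le_abs_radixTail_sub (hb : ∀ k, 2 ≤ b k) {d d' : ℕ → ℕ} (hd : ∀ k, d k < b k)
    (hd' : ∀ k, d' k < b k) {n t : ℕ} (h0 : ∃ h, n ≤ h ∧ h < n + t ∧ d h ≠ 0)
    (h1 : ∃ h, n ≤ h ∧ h < n + t ∧ d h ≠ b h - 1) (hne : ∃ i < n, d i ≠ d' i) :
    1 / radixProd b (n + t) ≤ |radixTail b 0 d - radixTail b 0 d'| := by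
  classical
  obtain ⟨hin, hi⟩ := Nat.find_spec hne
  set i := Nat.find hne
  have hmin : ∀ j < i, d j = d' j := fun j hj => by
    by_contra hcon
    exact Nat.find_min hne hj ⟨hj.trans hin, hcon⟩
  rw [radixTail_zero_eq hb hd (i + 1), radixTail_zero_eq hb hd' (i + 1),
    Finset.sum_range_succ, Finset.sum_range_succ,
    Finset.sum_congr rfl fun j hj => by rw [hmin j (Finset.mem_range.1 hj)]]
  have hpos := radixProd_pos hb (i + 1)
  have hle : ∀ h, h < n + t → 1 / radixProd b (n + t) ≤ 1 / radixProd b (h + 1) := fun h hh =>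
    one_div_le_one_div_of_le (radixProd_pos hb _) (radixProd_mono hb hh)
  rcases lt_or_gt_of_ne hi with hlt | hgt
  · obtain ⟨h, hnh, hht, hh⟩ := h1
    have ht := radixTail_le_sub hb hd (hin.trans_le hnh : i + 1 ≤ h) hh
    have ht' := radixTail_nonneg hb (i + 1) d'
    have hdig : 1 / radixProd b (i + 1) ≤ (d' i : ℝ) / radixProd b (i + 1) -
        d i / radixProd b (i + 1) := by
      rw [← sub_div]
      refine div_le_div_of_nonneg_right ?_ hpos.le
      have : (d i : ℝ) + 1 ≤ d' i := by exact_mod_cast hlt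
      linarith
    rw [abs_sub_comm]
    exact le_trans (by linarith [hle h hht]) (le_abs_self _)
  · obtain ⟨h, hnh, hht, hh⟩ := h0
    have ht := one_div_le_radixTail hb hd (hin.trans_le hnh : i + 1 ≤ h) hh
    have ht' := radixTail_le hb hd' (i + 1)
    have hdig : 1 / radixProd b (i + 1) ≤ (d i : ℝ) / radixProd b (i + 1) -
        d' i / radixProd b (i + 1) := by
      rw [← sub_div]
      refine div_le_div_of_nonneg_right ?_ hpos.le
      have : (d' i : ℝ) + 1 ≤ d i := by exact_mod_cast hgt
      linarith
    exact le_trans (by linarith [hle h hht]) (le_abs_self _)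

end MixedRadix

/-! ### Two estimates: second moments of information, and gaps in sets of positive density. -/

/-- Follows from `|√y log y| < 2` on `(0, 1]`. -/
theorem mul_log_sq_le {x y : ℝ} (hx : 0 ≤ x) (hxy : x ≤ y) (hy : y ≤ 1) :
    x * Real.log y ^ 2 ≤ 4 := by
  rcases (hx.trans hxy).eq_or_lt with h | h
  · simp [← h]
  have h1 := Real.abs_log_mul_self_rpow_lt y (1 / 2) h hy (by norm_num)
  have h2 : (Real.log y * y ^ (1 / 2 : ℝ)) ^ 2 ≤ (1 / (1 / 2)) ^ 2 := by
    rw [← sq_abs]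
    exact pow_le_pow_left₀ (abs_nonneg _) h1.le 2
  rw [mul_pow, ← Real.sqrt_eq_rpow, Real.sq_sqrt h.le] at h2
  nlinarith [mul_le_mul_of_nonneg_right hxy (sq_nonneg (Real.log y))]

theorem HasPosDensity.eventually_exists {Q : ℕ → Prop} (hQ : HasPosDensity Q) {δ : ℝ}
    (hδ : 0 < δ) : ∀ᶠ n : ℕ in atTop, ∃ h, n ≤ h ∧ h < n + ⌈δ * n⌉₊ ∧ Q h := by
  classical
  obtain ⟨c, hc, hlim⟩ := hQ
  -- This solves `(c - η)(1 + δ) = c + η`: an empty window of relative length `δ` would push the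
  -- proportion from below `c + η` to below `c - η`.
  set η := c * δ / (2 + δ) with hη
  have hη0 : 0 < η := by positivity
  have hηeq : η * (2 + δ) = c * δ := div_mul_cancel₀ _ (by positivity)
  obtain ⟨N, hN⟩ := Metric.tendsto_atTop.1 hlim η hη0
  refine eventually_atTop.2 ⟨N + 1, fun n hn => ?_⟩
  by_contra! hcon
  set t := ⌈δ * n⌉₊ with ht
  have hsame : (Finset.range (n + t)).filter Q = (Finset.range n).filter Q := by
    ext h
    simp only [Finset.mem_filter, Finset.mem_range]
    refine ⟨fun ⟨h1, h2⟩ => ⟨?_, h2⟩, fun ⟨h1, h2⟩ => ⟨by omega, h2⟩⟩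
    by_contra h3
    exact hcon h (by omega) h1 h2
  have h1 := abs_lt.1 (Real.dist_eq _ _ ▸ hN n (by omega))
  have h2 := abs_lt.1 (Real.dist_eq _ _ ▸ hN (n + t) (by omega))
  have hn0 : (0 : ℝ) < n := by exact_mod_cast (by omega : 0 < n)
  have hnt0 : (0 : ℝ) < (n + t : ℕ) := by exact_mod_cast (by omega : 0 < n + t)
  have e1 : (((Finset.range n).filter Q).card : ℝ) < (c + η) * n := by
    rw [← div_lt_iff₀ hn0]; linarith [h1.2]
  have e2 : (c - η) * (n + t : ℕ) < (((Finset.range n).filter Q).card : ℝ) := by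
    rw [← lt_div_iff₀ hnt0, ← hsame]; linarith [h2.1]
  have htn : δ * n ≤ t := Nat.le_ceil _
  have hcη : 0 < c - η := by
    have : η < c := by
      rw [hη, div_lt_iff₀ (by positivity)]; nlinarith
    linarith
  have e3 : (c - η) * (n + δ * n) ≤ (c - η) * (n + t : ℕ) := by
    push_cast
    exact mul_le_mul_of_nonneg_left (by linarith) hcη.le
  have e4 : (c - η) * (n + δ * n) = (c + η) * n := by linear_combination (-(n : ℝ)) * hηeq
  linarith

/-! ### The symbolic measure and the mass of approximate squares. -/

namespace MoranConstruction

variable (S : MoranConstruction) (p : S.ProbSeq)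

instance : IsProbabilityMeasure (S.symbolicMeasure p) := by
  unfold symbolicMeasure; infer_instance

theorem prob_nonneg (i : ℕ) (d : S.D i) : 0 ≤ S.prob p i d := ENNReal.toReal_nonneg

theorem toReal_toMeasure (i : ℕ) (Q : S.D i → Prop) [DecidablePred Q] :
    ((p i).toMeasure {d | Q d}).toReal = ∑ d : S.D i with Q d, S.prob p i d := by
  have : ({d | Q d} : Set (S.D i)) = (Finset.univ.filter Q : Finset (S.D i)) := by ext; simp
  rw [this, PMF.toMeasure_apply_finset, ENNReal.toReal_sum fun d _ => (p i).apply_ne_top d]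
  rfl

theorem prob_eq (i : ℕ) (d : S.D i) : S.prob p i d = ((p i).toMeasure {d}).toReal := by
  rw [PMF.toMeasure_apply_singleton _ _ (measurableSet_singleton d)]; rfl

theorem rowProb_eq (i j : ℕ) : S.rowProb p i j = ((p i).toMeasure {d | d.1.2 = j}).toReal :=
  (S.toReal_toMeasure p i _).symm

theorem colProb_eq (i j : ℕ) : S.colProb p i j = ((p i).toMeasure {d | d.1.1 = j}).toReal :=
  (S.toReal_toMeasure p i _).symm

theorem prob_le_one (i : ℕ) (d : S.D i) : S.prob p i d ≤ 1 := by
  rw [prob_eq]; exact measureReal_le_one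

theorem rowProb_le_one (i j : ℕ) : S.rowProb p i j ≤ 1 := by
  rw [rowProb_eq]; exact measureReal_le_one

theorem colProb_le_one (i j : ℕ) : S.colProb p i j ≤ 1 := by
  rw [colProb_eq]; exact measureReal_le_one

theorem prob_le_rowProb (i : ℕ) (d : S.D i) : S.prob p i d ≤ S.rowProb p i d.1.2 := by
  rw [prob_eq, rowProb_eq]; exact measureReal_mono (by simp)

theorem prob_le_colProb (i : ℕ) (d : S.D i) : S.prob p i d ≤ S.colProb p i d.1.1 := by
  rw [prob_eq, colProb_eq]; exact measureReal_mono (by simp)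

theorem integral_digit (i : ℕ) (f : S.D i → ℝ) :
    ∫ w, f (w i) ∂S.symbolicMeasure p = ∑ d, S.prob p i d * f d := by
  have h1 := integral_map (μ := S.symbolicMeasure p) (φ := fun w : S.Word => w i)
    (measurable_pi_apply i).aemeasurable (f := f)
    (measurable_of_countable f).aestronglyMeasurable
  rw [← h1, symbolicMeasure, Measure.infinitePi_map_eval, PMF.integral_eq_sum]
  rfl

theorem ae_eventually_abs_sum_digit_sub_le (f : (i : ℕ) → S.D i → ℝ) (h0 : ∀ i d, 0 ≤ f i d)
    {V : ℝ} (hV : ∀ i, ∑ d, S.prob p i d * f i d ^ 2 ≤ V) {ε : ℝ} (hε : 0 < ε) :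
    ∀ᵐ w ∂S.symbolicMeasure p, ∀ᶠ n : ℕ in atTop,
      |∑ i ∈ Finset.range n, f i (w i) - ∑ i ∈ Finset.range n, ∑ d, S.prob p i d * f i d|
        ≤ ε * n := by
  have hmeas : ∀ i, Measurable (f i) := fun i => measurable_of_countable _
  have key := ae_eventually_abs_sum_sub_le (P := S.symbolicMeasure p)
    (X := fun i w => f i (w i)) (fun i w => h0 i (w i)) (fun i => ?_) (fun i j hij => ?_)
    (V := V) (fun i => ?_) hε
  · simpa only [S.integral_digit p] using key
  · refine MemLp.of_bound ((hmeas i).comp (measurable_pi_apply i)).aestronglyMeasurable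
      (∑ d, f i d) (ae_of_all _ fun w => ?_)
    rw [Real.norm_of_nonneg (h0 i _)]
    exact Finset.single_le_sum (fun d _ => h0 i d) (Finset.mem_univ (w i))
  · exact (ProbabilityTheory.iIndepFun_infinitePi hmeas).indepFun hij
  · rw [S.integral_digit p i fun d => f i d ^ 2]
    exact hV i

/-- The approximate square of order `k` around a word. -/
def approxSquare (k : ℕ) (w : S.Word) : Set S.Word :=
  {v | (∀ i < k, (v i).1.2 = (w i).1.2) ∧ ∀ i < S.ell k, (v i).1.1 = (w i).1.1}

/-- The information `-log ν_p(Q_k(w))` of the approximate square, as a sum over the digits. -/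
noncomputable def information (k : ℕ) (w : S.Word) : ℝ :=
  if S.ell k ≤ k then
    -((∑ i ∈ Finset.range (S.ell k), Real.log (S.prob p i (w i))) +
      ∑ i ∈ Finset.Ico (S.ell k) k, Real.log (S.rowProb p i (w i).1.2))
  else
    -((∑ i ∈ Finset.range k, Real.log (S.prob p i (w i))) +
      ∑ i ∈ Finset.Ico k (S.ell k), Real.log (S.colProb p i (w i).1.1))

/-- The square is a product cylinder: below both thresholds the whole digit is fixed, between them
only its row or its column. Positivity of the digit masses is needed because `Real.log 0 = 0`. -/
theorem approxSquare_measure (k : ℕ) (w : S.Word) (hw : ∀ i, 0 < S.prob p i (w i)) :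
    (S.symbolicMeasure p (S.approxSquare k w)).toReal = Real.exp (-S.information p k w) := by
  set t : (i : ℕ) → Set (S.D i) := fun i =>
    {d | (i < k → d.1.2 = (w i).1.2) ∧ (i < S.ell k → d.1.1 = (w i).1.1)} with ht
  have hpi : S.approxSquare k w = (Finset.range (max k (S.ell k)) : Set ℕ).pi t := by
    ext v
    simp only [approxSquare, Set.mem_ofPred_eq, Set.mem_pi, Finset.coe_range, Set.mem_Iio, ht]
    exact ⟨fun h i _ => ⟨h.1 i, h.2 i⟩, fun h =>
      ⟨fun i hi => (h i (hi.trans_le (le_max_left _ _))).1 hi,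
        fun i hi => (h i (hi.trans_le (le_max_right _ _))).2 hi⟩⟩
  have hboth : ∀ i, i < k → i < S.ell k → ((p i).toMeasure (t i)).toReal = S.prob p i (w i) := by
    intro i h1 h2
    rw [prob_eq]
    congr 2
    ext d
    simp only [ht, h1, h2, Set.mem_ofPred_eq, forall_const, Set.mem_singleton_iff,
      Subtype.ext_iff, Prod.ext_iff]
    exact and_comm
  have hrow : ∀ i, i < k → S.ell k ≤ i →
      ((p i).toMeasure (t i)).toReal = S.rowProb p i (w i).1.2 := by
    intro i h1 h2
    rw [rowProb_eq]
    congr 2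
    ext d
    simp [ht, h1, h2.not_gt]
  have hcol : ∀ i, k ≤ i → i < S.ell k →
      ((p i).toMeasure (t i)).toReal = S.colProb p i (w i).1.1 := by
    intro i h1 h2
    rw [colProb_eq]
    congr 2
    ext d
    simp [ht, h1.not_gt, h2]
  rw [hpi, symbolicMeasure, Measure.infinitePi_pi _ fun i _ => MeasurableSet.of_discrete,
    ENNReal.toReal_prod]
  unfold information
  split_ifs with hl
  · rw [max_eq_left hl, ← Finset.prod_range_mul_prod_Ico _ hl, neg_neg, Real.exp_add,
      Real.exp_sum, Real.exp_sum]
    congr 1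
    · refine Finset.prod_congr rfl fun i hi => ?_
      have hi := Finset.mem_range.1 hi
      rw [hboth i (hi.trans_le hl) hi, Real.exp_log (hw i)]
    · refine Finset.prod_congr rfl fun i hi => ?_
      have hi := Finset.mem_Ico.1 hi
      rw [hrow i hi.2 hi.1, Real.exp_log ((hw i).trans_le (S.prob_le_rowProb p i _))]
  · push Not at hl
    rw [max_eq_right hl.le, ← Finset.prod_range_mul_prod_Ico _ hl.le, neg_neg, Real.exp_add,
      Real.exp_sum, Real.exp_sum]
    congr 1
    · refine Finset.prod_congr rfl fun i hi => ?_
      have hi := Finset.mem_range.1 hi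
      rw [hboth i hi (hi.trans hl), Real.exp_log (hw i)]
    · refine Finset.prod_congr rfl fun i hi => ?_
      have hi := Finset.mem_Ico.1 hi
      rw [hcol i hi.1 hi.2, Real.exp_log ((hw i).trans_le (S.prob_le_colProb p i _))]

theorem ae_prob_pos : ∀ᵐ w ∂S.symbolicMeasure p, ∀ i, 0 < S.prob p i (w i) := by
  refine ae_all_iff.2 fun i => ?_
  have h1 : ∀ᵐ d ∂(p i).toMeasure, 0 < S.prob p i d := by
    rw [ae_iff, ← measureReal_eq_zero_iff, measureReal_def]
    classical
    rw [toReal_toMeasure]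
    exact Finset.sum_eq_zero fun d hd =>
      le_antisymm (not_lt.1 (Finset.mem_filter.1 hd).2) (S.prob_nonneg p i d)
  have h2 := Measure.infinitePi_map_eval (fun k => (p k).toMeasure) i
  rw [← h2] at h1
  exact ae_of_ae_map (measurable_pi_apply i).aemeasurable h1

/-! ### Comparison of `k` with `ell k`, and concentration of the information. -/

variable {S}

/-- A power of two as bound turns comparisons of products into comparisons of exponents. -/
theorem BoundedDigits.exists_bound (hN : S.BoundedDigits) :
    ∃ β : ℕ, 1 ≤ β ∧ ∀ k, S.n k ≤ 2 ^ β ∧ S.m k ≤ 2 ^ β := by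
  obtain ⟨B, hB⟩ := hN
  have h : B ≤ 2 ^ (B + 1) := (Nat.lt_two_pow_self.le).trans (Nat.pow_le_pow_right two_pos B.le_succ)
  exact ⟨B + 1, by omega, fun k => ⟨(hB (Or.inl ⟨k, rfl⟩)).trans h, (hB (Or.inr ⟨k, rfl⟩)).trans h⟩⟩

section Ell

variable {β : ℕ} (hβ : ∀ k, S.n k ≤ 2 ^ β ∧ S.m k ≤ 2 ^ β)
include hβ

theorem mul_mem_ell_set (k : ℕ) :
    ∏ i ∈ Finset.range k, S.m i ≤ ∏ i ∈ Finset.range (β * k), S.n i :=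
  calc ∏ i ∈ Finset.range k, S.m i ≤ ∏ _i ∈ Finset.range k, 2 ^ β :=
        Finset.prod_le_prod' fun i _ => (hβ i).2
    _ = ∏ _i ∈ Finset.range (β * k), 2 := by simp [pow_mul]
    _ ≤ _ := Finset.prod_le_prod' fun i _ => S.two_le_n i

theorem ell_le (k : ℕ) : S.ell k ≤ β * k := Nat.sInf_le (mul_mem_ell_set hβ k)

theorem prod_m_le_prod_n_ell (k : ℕ) :
    ∏ i ∈ Finset.range k, S.m i ≤ ∏ i ∈ Finset.range (S.ell k), S.n i :=
  Nat.sInf_mem (s := {l : ℕ | ∏ i ∈ Finset.range k, S.m i ≤ ∏ i ∈ Finset.range l, S.n i})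
    ⟨_, mul_mem_ell_set hβ k⟩

theorem le_mul_ell (k : ℕ) : k ≤ β * S.ell k := by
  refine (Nat.pow_le_pow_iff_right one_lt_two).1 ?_
  calc 2 ^ k = ∏ _i ∈ Finset.range k, 2 := by simp
    _ ≤ ∏ i ∈ Finset.range k, S.m i := Finset.prod_le_prod' fun i _ => S.two_le_m i
    _ ≤ ∏ i ∈ Finset.range (S.ell k), S.n i := prod_m_le_prod_n_ell hβ k
    _ ≤ ∏ _i ∈ Finset.range (S.ell k), 2 ^ β := Finset.prod_le_prod' fun i _ => (hβ i).1
    _ = _ := by simp [pow_mul]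

theorem tendsto_ell : Tendsto S.ell atTop atTop := by
  refine tendsto_atTop.2 fun c => eventually_atTop.2 ⟨β * c + 1, fun k hk => ?_⟩
  by_contra! h
  have h1 := le_mul_ell hβ k
  have h2 : β * S.ell k ≤ β * c := Nat.mul_le_mul_left _ h.le
  omega

/-- By minimality of `ell k`, the product overshoots by at most its last factor. -/
theorem prod_n_ell_le (k : ℕ) :
    ∏ i ∈ Finset.range (S.ell k), S.n i ≤ 2 ^ β * ∏ i ∈ Finset.range k, S.m i := by
  rcases h : S.ell k with _ | l
  · simp only [Finset.range_zero, Finset.prod_empty]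
    exact Nat.one_le_iff_ne_zero.2 (mul_ne_zero (by positivity)
      (Finset.prod_ne_zero_iff.2 fun i _ => by have := S.two_le_m i; omega))
  · have h1 : l ∉ {l : ℕ | ∏ i ∈ Finset.range k, S.m i ≤ ∏ i ∈ Finset.range l, S.n i} :=
      Nat.notMem_of_lt_sInf (by change l < S.ell k; omega)
    simp only [Set.mem_ofPred_eq, not_le] at h1
    rw [Finset.prod_range_succ, mul_comm]
    exact Nat.mul_le_mul (hβ l).1 h1.le

theorem radixProd_m_le (k : ℕ) : radixProd S.m k ≤ radixProd S.n (S.ell k) := by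
  unfold radixProd
  exact_mod_cast prod_m_le_prod_n_ell hβ k

theorem radixProd_n_le (k : ℕ) : radixProd S.n (S.ell k) ≤ 2 ^ β * radixProd S.m k := by
  unfold radixProd
  exact_mod_cast prod_n_ell_le hβ k

theorem card_digits_le (i : ℕ) : (S.D i).card ≤ 2 ^ β * 2 ^ β := by
  have h : S.D i ⊆ Finset.range (2 ^ β) ×ˢ Finset.range (2 ^ β) := fun d hd => by
    have h1 := S.digit_lt i d hd
    exact Finset.mem_product.2 ⟨Finset.mem_range.2 (h1.1.trans_le (hβ i).1),
      Finset.mem_range.2 (h1.2.trans_le (hβ i).2)⟩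
  simpa using Finset.card_le_card h

theorem ae_eventually_abs_sum_log_sub_le (q : (i : ℕ) → S.D i → ℝ)
    (hq : ∀ i d, S.prob p i d ≤ q i d) (hq1 : ∀ i d, q i d ≤ 1) {ε : ℝ} (hε : 0 < ε) :
    ∀ᵐ w ∂S.symbolicMeasure p, ∀ᶠ n : ℕ in atTop,
      |∑ i ∈ Finset.range n, Real.log (q i (w i)) -
        ∑ i ∈ Finset.range n, ∑ d, S.prob p i d * Real.log (q i d)| ≤ ε * n := by
  have h0 : ∀ i d, 0 ≤ q i d := fun i d => (S.prob_nonneg p i d).trans (hq i d)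
  have key := S.ae_eventually_abs_sum_digit_sub_le p (fun i d => -Real.log (q i d))
    (fun i d => neg_nonneg.2 (Real.log_nonpos (h0 i d) (hq1 i d)))
    (V := (2 ^ β * 2 ^ β : ℕ) * 4) (fun i => ?_) hε
  · filter_upwards [key] with w hw
    filter_upwards [hw] with n hn
    simpa only [mul_neg, Finset.sum_neg_distrib, sub_neg_eq_add, neg_add_eq_sub,
      abs_sub_comm] using hn
  · calc ∑ d, S.prob p i d * (-Real.log (q i d)) ^ 2 ≤ ∑ _d : S.D i, (4 : ℝ) := by
          refine Finset.sum_le_sum fun d _ => ?_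
          rw [neg_sq]
          exact mul_log_sq_le (S.prob_nonneg p i d) (hq i d) (hq1 i d)
      _ = (S.D i).card * 4 := by simp
      _ ≤ _ := mul_le_mul_of_nonneg_right (Nat.cast_le.2 (card_digits_le hβ i)) (by norm_num)

/-- The sum over levels between `k` and `ell k` is a difference of two initial sums. Three
applications of the law of large numbers, at times `k` or `ell k`, thus suffice, each with error at
most `ε k / 3` since both times are at most `β k`. -/
theorem ae_eventually_abs_information_sub_entropy_le (hβ1 : 1 ≤ β) {ε : ℝ} (hε : 0 < ε) :
    ∀ᵐ w ∂S.symbolicMeasure p, ∀ᶠ k : ℕ in atTop,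
      |S.information p k w - S.entropy p k| ≤ ε * k := by
  have hβ0 : (1 : ℝ) ≤ β := by exact_mod_cast hβ1
  have hη : 0 < ε / (3 * β) := by positivity
  have hell := tendsto_ell hβ
  filter_upwards [
    ae_eventually_abs_sum_log_sub_le p hβ (S.prob p) (fun _ _ => le_rfl) (S.prob_le_one p) hη,
    ae_eventually_abs_sum_log_sub_le p hβ (fun i d => S.rowProb p i d.1.2)
      (S.prob_le_rowProb p) (fun i d => S.rowProb_le_one p i _) hη,
    ae_eventually_abs_sum_log_sub_le p hβ (fun i d => S.colProb p i d.1.1)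
      (S.prob_le_colProb p) (fun i d => S.colProb_le_one p i _) hη] with w h1 h2 h3
  filter_upwards [h1, h2, h3, hell.eventually h1, hell.eventually h2, hell.eventually h3]
    with k a1 a2 a3 b1 b2 b3
  have hl : (S.ell k : ℝ) ≤ β * k := by exact_mod_cast ell_le hβ k
  have hkb : (k : ℝ) ≤ β * k := le_mul_of_one_le_left k.cast_nonneg hβ0
  have he : ε / (3 * β) * (β * k) = ε * k / 3 := by field_simp
  have c1 : ε / (3 * β) * (S.ell k : ℝ) ≤ ε * k / 3 :=
    (mul_le_mul_of_nonneg_left hl hη.le).trans_eq he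
  have c2 : ε / (3 * β) * (k : ℝ) ≤ ε * k / 3 :=
    (mul_le_mul_of_nonneg_left hkb hη.le).trans_eq he
  rw [abs_le] at a1 a2 a3 b1 b2 b3
  unfold information entropy
  split_ifs with hlk
  · rw [Finset.sum_Ico_eq_sub _ hlk, Finset.sum_Ico_eq_sub _ hlk, abs_le]
    constructor <;> linarith
  · push Not at hlk
    rw [Finset.sum_Ico_eq_sub _ hlk.le, Finset.sum_Ico_eq_sub _ hlk.le, abs_le]
    constructor <;> linarith

end Ell

/-! ### Separation: bad digits do not fill long windows. -/

variable (S)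

/-- Here BSC and MSC become one statement. Positive density of levels with no bad digit settles it
for every word; otherwise a window of bad digits has probability at most `C ^ (δ n)`, and
Borel–Cantelli applies. -/
theorem ae_eventually_exists_notMem (Z : (h : ℕ) → Set (S.D h))
    (hZ : HasPosDensity (fun h => Z h = ∅) ∨
      ∃ C : ℝ, 0 < C ∧ C < 1 ∧ ∀ h, ((p h).toMeasure (Z h)).toReal ≤ C) {δ : ℝ} (hδ : 0 < δ) :
    ∀ᵐ w ∂S.symbolicMeasure p, ∀ᶠ n : ℕ in atTop,
      ∃ h, n ≤ h ∧ h < n + ⌈δ * n⌉₊ ∧ w h ∉ Z h := by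
  rcases hZ with hZ | ⟨C, hC0, hC1, hC⟩
  · refine ae_of_all _ fun w => (hZ.eventually_exists hδ).mono fun n ⟨h, h1, h2, h3⟩ =>
      ⟨h, h1, h2, by simp [h3]⟩
  · have hle : ∀ n : ℕ, S.symbolicMeasure p
        ((Finset.Ico n (n + ⌈δ * n⌉₊) : Set ℕ).pi Z) ≤ ENNReal.ofReal ((C ^ δ) ^ n) := fun n => by
      rw [symbolicMeasure, Measure.infinitePi_pi _ fun i _ => MeasurableSet.of_discrete]
      calc ∏ i ∈ Finset.Ico n (n + ⌈δ * n⌉₊), (p i).toMeasure (Z i)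
          ≤ ∏ _i ∈ Finset.Ico n (n + ⌈δ * n⌉₊), ENNReal.ofReal C :=
            Finset.prod_le_prod' fun i _ => ENNReal.le_ofReal_iff_toReal_le
              (measure_ne_top _ _) hC0.le |>.2 (hC i)
        _ = ENNReal.ofReal (C ^ ⌈δ * n⌉₊) := by simp [ENNReal.ofReal_pow hC0.le]
        _ ≤ _ := by
            refine ENNReal.ofReal_le_ofReal ?_
            rw [← Real.rpow_natCast, ← Real.rpow_natCast (C ^ δ), ← Real.rpow_mul hC0.le]
            exact Real.rpow_le_rpow_of_exponent_ge hC0 hC1.le (Nat.le_ceil _)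
    have hsum : Summable fun n : ℕ => (C ^ δ) ^ n :=
      summable_geometric_of_lt_one (Real.rpow_nonneg hC0.le _) (Real.rpow_lt_one hC0.le hC1 hδ)
    have hBC := ae_eventually_notMem (μ := S.symbolicMeasure p)
      (ne_top_of_le_ne_top hsum.tsum_ofReal_ne_top (ENNReal.tsum_le_tsum hle))
    filter_upwards [hBC] with w hw
    filter_upwards [hw] with n hn
    simp only [Set.mem_pi, Finset.coe_Ico, Set.mem_Ico] at hn
    push Not at hn
    obtain ⟨h, ⟨h1, h2⟩, h3⟩ := hn
    exact ⟨h, h1, h2, h3⟩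

end MoranConstruction

/-! ### Growth of radix products, measurability, and passage from discrete scales to all radii. -/

theorem radixProd_add_le {b : ℕ → ℕ} (hb : ∀ k, 2 ≤ b k) {β : ℕ} (hβ : ∀ k, b k ≤ 2 ^ β)
    (k t : ℕ) : radixProd b (k + t) ≤ radixProd b k * (2 ^ β) ^ t := by
  induction t with
  | zero => simp
  | succ t ih =>
    rw [← add_assoc, radixProd_succ, pow_succ, ← mul_assoc]
    exact mul_le_mul ih (by exact_mod_cast hβ _) (Nat.cast_nonneg _)
      (mul_nonneg (radixProd_pos hb k).le (by positivity))

theorem measurable_radixTail {Ω : Type*} [MeasurableSpace Ω] {b : ℕ → ℕ} (hb : ∀ k, 2 ≤ b k)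
    {d : Ω → ℕ → ℕ} (hd : ∀ ω k, d ω k < b k) (hm : ∀ k, Measurable fun ω => d ω k) :
    Measurable fun ω => radixTail b 0 (d ω) := by
  refine measurable_of_tendsto_metrizable
    (f := fun n ω => ∑ k ∈ Finset.range n, (d ω (k + 0) : ℝ) / radixProd b (k + 0 + 1))
    (fun n => ?_) (tendsto_pi_nhds.2 fun ω => (summable_digits hb (hd ω) 0).hasSum.tendsto_sum_nat)
  exact Finset.measurable_sum _ fun k _ =>
    ((measurable_of_countable (fun j : ℕ => (j : ℝ))).comp (hm _)).div_const _

/-- Needed to move almost-sure statements through the coding map, since `ae_map_iff` asks for a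
measurable set. -/
theorem measurable_measure_closedBall {X : Type*} [PseudoMetricSpace X]
    [SecondCountableTopology X] [MeasurableSpace X] [OpensMeasurableSpace X] (μ : Measure X)
    [SFinite μ] (r : ℝ) : Measurable fun x => μ (Metric.closedBall x r) := by
  have hs : MeasurableSet {q : X × X | dist q.2 q.1 ≤ r} :=
    (isClosed_le (continuous_snd.dist continuous_fst) continuous_const).measurableSet
  exact measurable_measure_prodMk_left hs

theorem eventually_nhdsGT_of_scales {r : ℕ → ℝ} (hr : Antitone r) (h0 : ∀ k, 0 < r k)
    (hlim : Tendsto r atTop (𝓝 0)) {R : ℝ → Prop}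
    (h : ∀ᶠ k in atTop, ∀ x, r (k + 1) < x → x ≤ r k → R x) : ∀ᶠ x in 𝓝[>] (0 : ℝ), R x := by
  obtain ⟨K, hK⟩ := eventually_atTop.1 h
  filter_upwards [Ioc_mem_nhdsGT (h0 K)] with x hx
  have hex : ∃ j, r j < x := (hlim.eventually_lt_const hx.1).exists
  classical
  have hj := Nat.find_spec hex
  -- The first scale below `x`; the scales `j` and `j - 1` bracket it.
  set j := Nat.find hex with hjdef
  have hKj : K < j := by
    by_contra! hle
    exact (hj.trans_le hx.2).not_ge (hr hle)
  refine hK (j - 1) (by omega) x ?_ (not_lt.1 (Nat.find_min hex (by omega)))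
  rwa [Nat.sub_add_cancel (by omega)]

theorem measurableSet_eventually_atTop {X : Type*} [MeasurableSpace X] {Q : ℕ → X → Prop}
    (h : ∀ k, MeasurableSet {x | Q k x}) : MeasurableSet {x | ∀ᶠ k in atTop, Q k x} := by
  have : {x | ∀ᶠ k in atTop, Q k x} = ⋃ K, ⋂ k, ⋂ (_ : K ≤ k), {x | Q k x} := by
    ext x; simp [eventually_atTop]
  rw [this]
  exact .iUnion fun K => .iInter fun k => .iInter fun _ => h k

/-! ### The projected measure: approximate squares against Euclidean balls. -/

namespace MoranConstruction

variable (S : MoranConstruction) (p : S.ProbSeq)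

theorem column_lt (w : S.Word) (k : ℕ) : (w k).1.1 < S.n k := (S.digit_lt k _ (w k).2).1

theorem row_lt (w : S.Word) (k : ℕ) : (w k).1.2 < S.m k := (S.digit_lt k _ (w k).2).2

theorem measurable_proj : Measurable S.proj := by
  refine (PiLp.continuous_toLp 2 fun _ : Fin 2 => ℝ).measurable.comp (measurable_pi_iff.2 fun a => ?_)
  fin_cases a
  · exact measurable_radixTail S.two_le_n S.column_lt fun k =>
      (measurable_of_countable fun d : S.D k => d.1.1).comp (measurable_pi_apply k)
  · exact measurable_radixTail S.two_le_m S.row_lt fun k =>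
      (measurable_of_countable fun d : S.D k => d.1.2).comp (measurable_pi_apply k)

instance : IsProbabilityMeasure (S.moranMeasure p) :=
  Measure.isProbabilityMeasure_map S.measurable_proj.aemeasurable

/-- `log (m₁ ⋯ m_k)`. -/
noncomputable def logHeight (k : ℕ) : ℝ := ∑ i ∈ Finset.range k, Real.log (S.m i)

theorem exp_logHeight (k : ℕ) : Real.exp (S.logHeight k) = radixProd S.m k := by
  rw [logHeight, Real.exp_sum, radixProd]
  exact Finset.prod_congr rfl fun i _ => Real.exp_log (by have := S.two_le_m i; positivity)

theorem logHeight_succ (k : ℕ) : S.logHeight (k + 1) = S.logHeight k + Real.log (S.m k) :=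
  Finset.sum_range_succ _ _

theorem log_two_le_log_m (k : ℕ) : Real.log 2 ≤ Real.log (S.m k) :=
  Real.log_le_log two_pos (by exact_mod_cast S.two_le_m k)

theorem le_logHeight (k : ℕ) : k * Real.log 2 ≤ S.logHeight k := by
  calc (k : ℝ) * Real.log 2 = ∑ _i ∈ Finset.range k, Real.log 2 := by simp
    _ ≤ _ := Finset.sum_le_sum fun i _ => S.log_two_le_log_m i

theorem logHeight_mono : Monotone S.logHeight := monotone_nat_of_le_succ fun k => by
  rw [logHeight_succ]
  linarith [S.log_two_le_log_m k, Real.log_pos one_lt_two]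

theorem tendsto_logHeight : Tendsto S.logHeight atTop atTop :=
  tendsto_atTop_mono S.le_logHeight
    (tendsto_natCast_atTop_atTop.atTop_mul_const (Real.log_pos one_lt_two))

theorem entropy_eq (k : ℕ) (hk : k ≠ 0) :
    S.entropy p k = S.entropyRatio p k * S.logHeight k := by
  have h1 : 0 < S.logHeight k := lt_of_lt_of_le
    (mul_pos (by positivity) (Real.log_pos one_lt_two)) (S.le_logHeight k)
  exact (div_mul_cancel₀ _ h1.ne').symm

theorem entropy_nonneg (k : ℕ) : 0 ≤ S.entropy p k := by
  have h : ∀ i (q : S.D i → ℝ), (∀ d, S.prob p i d ≤ q d) → (∀ d, q d ≤ 1) →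
      ∑ d, S.prob p i d * Real.log (q d) ≤ 0 := fun i q h0 h1 =>
    Finset.sum_nonpos fun d _ => mul_nonpos_of_nonneg_of_nonpos (S.prob_nonneg p i d)
      (Real.log_nonpos ((S.prob_nonneg p i d).trans (h0 d)) (h1 d))
  unfold entropy
  split_ifs
  · exact neg_nonneg.2 (add_nonpos
      (Finset.sum_nonpos fun i _ => h i _ (fun _ => le_rfl) (S.prob_le_one p i))
      (Finset.sum_nonpos fun i _ => h i (fun d => S.rowProb p i d.1.2)
        (S.prob_le_rowProb p i) fun d => S.rowProb_le_one p i _))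
  · exact neg_nonneg.2 (add_nonpos
      (Finset.sum_nonpos fun i _ => h i _ (fun _ => le_rfl) (S.prob_le_one p i))
      (Finset.sum_nonpos fun i _ => h i (fun d => S.colProb p i d.1.1)
        (S.prob_le_colProb p i) fun d => S.colProb_le_one p i _))

theorem entropyRatio_nonneg (k : ℕ) : 0 ≤ S.entropyRatio p k :=
  div_nonneg (S.entropy_nonneg p k) ((by positivity : (0 : ℝ) ≤ k * Real.log 2).trans
    (S.le_logHeight k))

theorem abs_sub_le_dist_proj (v w : S.Word) (a : Fin 2) :
    |S.proj v a - S.proj w a| ≤ dist (S.proj v) (S.proj w) := by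
  rw [dist_eq_norm]
  exact PiLp.norm_apply_le (S.proj v - S.proj w) a

variable {S} {β : ℕ}

theorem approxSquare_subset (hβ : ∀ k, S.n k ≤ 2 ^ β ∧ S.m k ≤ 2 ^ β) (k : ℕ) (w : S.Word) :
    S.approxSquare k w ⊆
      S.proj ⁻¹' Metric.closedBall (S.proj w) (2 * Real.exp (-S.logHeight k)) := by
  rintro v ⟨hv1, hv2⟩
  have h0 : |S.proj v 0 - S.proj w 0| ≤ Real.exp (-S.logHeight k) := by
    rw [Real.exp_neg, exp_logHeight, ← one_div]
    exact (abs_radixTail_sub_le S.two_le_n (S.column_lt v) (S.column_lt w) hv2).trans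
      (one_div_le_one_div_of_le (radixProd_pos S.two_le_m k) (radixProd_m_le hβ k))
  have h1 : |S.proj v 1 - S.proj w 1| ≤ Real.exp (-S.logHeight k) := by
    rw [Real.exp_neg, exp_logHeight, ← one_div]
    exact abs_radixTail_sub_le S.two_le_m (S.row_lt v) (S.row_lt w) hv1
  rw [Set.mem_preimage, Metric.mem_closedBall, EuclideanSpace.dist_eq, Fin.sum_univ_two,
    Real.dist_eq, Real.dist_eq]
  have hE := Real.exp_pos (-S.logHeight k)
  refine Real.sqrt_le_iff.2 ⟨by positivity, ?_⟩
  nlinarith [abs_nonneg (S.proj v 0 - S.proj w 0), abs_nonneg (S.proj v 1 - S.proj w 1)]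

/-- A point of the ball coded outside the square differs from `w` in one of the fixed rows or
columns, and so is too far away by `le_abs_radixTail_sub`. The extra power in `t' + 1` pays for
`n₁⋯n_ell` exceeding `m₁⋯m_k` by a factor up to `2 ^ β`. -/
theorem preimage_closedBall_subset (hβ : ∀ k, S.n k ≤ 2 ^ β ∧ S.m k ≤ 2 ^ β) {k : ℕ}
    {w : S.Word} {r : ℝ} {t t' : ℕ} (hr : r * (radixProd S.m k * (2 ^ β) ^ t) < 1)
    (hr' : r * (radixProd S.m k * (2 ^ β) ^ (t' + 1)) < 1) (hr0 : 0 ≤ r)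
    (hB : ∃ h, k ≤ h ∧ h < k + t ∧ (w h).1.2 ≠ 0)
    (hT : ∃ h, k ≤ h ∧ h < k + t ∧ (w h).1.2 ≠ S.m h - 1)
    (hL : ∃ h, S.ell k ≤ h ∧ h < S.ell k + t' ∧ (w h).1.1 ≠ 0)
    (hR : ∃ h, S.ell k ≤ h ∧ h < S.ell k + t' ∧ (w h).1.1 ≠ S.n h - 1) :
    S.proj ⁻¹' Metric.closedBall (S.proj w) r ⊆ S.approxSquare k w := by
  intro v hv
  rw [Set.mem_preimage, Metric.mem_closedBall, dist_comm] at hv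
  constructor
  · by_contra! hne
    have h1 := le_abs_radixTail_sub S.two_le_m (S.row_lt w) (S.row_lt v) hB hT
      (hne.imp fun i hi => ⟨hi.1, hi.2.symm⟩)
    have h2 := h1.trans ((S.abs_sub_le_dist_proj w v 1).trans hv)
    rw [div_le_iff₀ (radixProd_pos S.two_le_m _)] at h2
    have h3 := mul_le_mul_of_nonneg_left
      (radixProd_add_le S.two_le_m (fun i => (hβ i).2) k t) hr0
    linarith
  · by_contra! hne
    have h1 := le_abs_radixTail_sub S.two_le_n (S.column_lt w) (S.column_lt v) hL hR
      (hne.imp fun i hi => ⟨hi.1, hi.2.symm⟩)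
    have h2 := h1.trans ((S.abs_sub_le_dist_proj w v 0).trans hv)
    rw [div_le_iff₀ (radixProd_pos S.two_le_n _)] at h2
    have h3 := mul_le_mul_of_nonneg_left
      (radixProd_add_le S.two_le_n (fun i => (hβ i).1) (S.ell k) t') hr0
    have h4 := mul_le_mul_of_nonneg_left (mul_le_mul_of_nonneg_right (radixProd_n_le hβ k)
      (by positivity : (0 : ℝ) ≤ (2 ^ β) ^ t')) hr0
    have h5 : (2 : ℝ) ^ β * radixProd S.m k * (2 ^ β) ^ t' =
      radixProd S.m k * (2 ^ β) ^ (t' + 1) := by ring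
    rw [h5] at h4
    linarith

theorem ae_separated (hsep : S.BSC ∨ S.MSC p) {δ : ℝ} (hδ : 0 < δ) :
    ∀ᵐ w ∂S.symbolicMeasure p, ∀ᶠ k : ℕ in atTop,
      (∃ h, k ≤ h ∧ h < k + ⌈δ * k⌉₊ ∧ (w h).1.2 ≠ 0) ∧
      (∃ h, k ≤ h ∧ h < k + ⌈δ * k⌉₊ ∧ (w h).1.2 ≠ S.m h - 1) ∧
      (∃ h, k ≤ h ∧ h < k + ⌈δ * k⌉₊ ∧ (w h).1.1 ≠ 0) ∧
      ∃ h, k ≤ h ∧ h < k + ⌈δ * k⌉₊ ∧ (w h).1.1 ≠ S.n h - 1 := by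
  have hempty : ∀ (f : (h : ℕ) → ℕ × ℕ → Prop),
      HasPosDensity (fun h => ∀ d ∈ S.D h, ¬ f h d) →
      HasPosDensity (fun h => {d : S.D h | f h d.1} = ∅) := fun f hf => by
    have heq : (fun h => {d : S.D h | f h d.1} = ∅) = fun h => ∀ d ∈ S.D h, ¬ f h d := by
      ext h
      rw [Set.eq_empty_iff_forall_notMem]
      exact ⟨fun H d hd => H ⟨d, hd⟩, fun H d => H d.1 d.2⟩
    rwa [heq]
  have hB := S.ae_eventually_exists_notMem p (fun h => {d | d.1.2 = 0}) (hsep.imp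
    (fun H => hempty (fun _ d => d.2 = 0) H.2.2.1)
    (fun ⟨C, h0, h1, H⟩ => ⟨C, h0, h1, fun h => S.rowProb_eq p h _ ▸ (H h).1.le⟩)) hδ
  have hT := S.ae_eventually_exists_notMem p (fun h => {d | d.1.2 = S.m h - 1}) (hsep.imp
    (fun H => hempty (fun h d => d.2 = S.m h - 1) H.2.2.2)
    (fun ⟨C, h0, h1, H⟩ => ⟨C, h0, h1, fun h => S.rowProb_eq p h _ ▸ (H h).2.1.le⟩)) hδ
  have hL := S.ae_eventually_exists_notMem p (fun h => {d | d.1.1 = 0}) (hsep.imp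
    (fun H => hempty (fun _ d => d.1 = 0) H.1)
    (fun ⟨C, h0, h1, H⟩ => ⟨C, h0, h1, fun h => S.colProb_eq p h _ ▸ (H h).2.2.1.le⟩)) hδ
  have hR := S.ae_eventually_exists_notMem p (fun h => {d | d.1.1 = S.n h - 1}) (hsep.imp
    (fun H => hempty (fun h d => d.1 = S.n h - 1) H.2.1)
    (fun ⟨C, h0, h1, H⟩ => ⟨C, h0, h1, fun h => S.colProb_eq p h _ ▸ (H h).2.2.2.le⟩)) hδ
  filter_upwards [hB, hT, hL, hR] with w h1 h2 h3 h4
  filter_upwards [h1, h2, h3, h4] with k k1 k2 k3 k4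
  exact ⟨k1, k2, k3, k4⟩

theorem moranMeasure_closedBall (x : EuclideanSpace ℝ (Fin 2)) (r : ℝ) :
    S.moranMeasure p (Metric.closedBall x r) =
      S.symbolicMeasure p (S.proj ⁻¹' Metric.closedBall x r) :=
  Measure.map_apply S.measurable_proj measurableSet_closedBall

theorem ae_eventually_le_measure_closedBall (hN : S.BoundedDigits) {ε : ℝ} (hε : 0 < ε) :
    ∀ᵐ x ∂S.moranMeasure p, ∀ᶠ k : ℕ in atTop,
      ENNReal.ofReal (Real.exp (-S.entropy p k - ε * k)) ≤
        S.moranMeasure p (Metric.closedBall x (2 * Real.exp (-S.logHeight k))) := by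
  obtain ⟨β, hβ1, hβ⟩ := hN.exists_bound
  refine (ae_map_iff S.measurable_proj.aemeasurable ?_).2 ?_
  · exact measurableSet_eventually_atTop fun k =>
      measurableSet_le measurable_const (measurable_measure_closedBall _ _)
  filter_upwards [S.ae_prob_pos p, ae_eventually_abs_information_sub_entropy_le p hβ hβ1 hε]
    with w hw hinf
  filter_upwards [hinf] with k hk
  rw [moranMeasure_closedBall]
  refine le_trans ?_ (measure_mono (approxSquare_subset hβ k w))
  rw [← ENNReal.ofReal_toReal (measure_ne_top _ (S.approxSquare k w)),
    S.approxSquare_measure p k w hw]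
  exact ENNReal.ofReal_le_ofReal (Real.exp_le_exp.2 (by linarith [(abs_le.1 hk).2]))

theorem ae_eventually_measure_closedBall_le (hN : S.BoundedDigits) (hsep : S.BSC ∨ S.MSC p)
    {ε : ℝ} (hε : 0 < ε) :
    ∀ᵐ x ∂S.moranMeasure p, ∀ᶠ k : ℕ in atTop,
      S.moranMeasure p (Metric.closedBall x (Real.exp (-S.logHeight k - ε * k))) ≤
        ENNReal.ofReal (Real.exp (-S.entropy p k + ε * k)) := by
  obtain ⟨β, hβ1, hβ⟩ := hN.exists_bound
  refine (ae_map_iff S.measurable_proj.aemeasurable ?_).2 ?_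
  · exact measurableSet_eventually_atTop fun k =>
      measurableSet_le (measurable_measure_closedBall _ _) measurable_const
  have hβ0 : (1 : ℝ) ≤ β := by exact_mod_cast hβ1
  have hlog := Real.log_pos one_lt_two
  -- A window starting at `ell k ≤ β k` has about `δ β k` levels, each costing at most `β log 2` on
  -- the logarithmic scale; the total is `ε k / 2`.
  set δ := ε / (2 * β ^ 2 * Real.log 2) with hδ
  have hδ0 : 0 < δ := by positivity
  have hδe : β * Real.log 2 * (δ * β) = ε / 2 := by rw [hδ]; field_simp
  filter_upwards [S.ae_prob_pos p, ae_eventually_abs_information_sub_entropy_le p hβ hβ1 hε,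
    ae_separated p hsep hδ0] with w hw hinf hse
  have hbig : ∀ᶠ k : ℕ in atTop, 2 * β * Real.log 2 / (ε / 2) < k :=
    tendsto_natCast_atTop_atTop.eventually_gt_atTop _
  filter_upwards [hinf, hse, (tendsto_ell hβ).eventually hse, hbig] with k hk hs hsl hkb
  obtain ⟨hB, hT, -, -⟩ := hs
  obtain ⟨-, -, hL, hR⟩ := hsl
  -- The `+ 2` covers the rounding in `⌈·⌉₊` and the extra power for columns; the other `ε k / 2`
  -- absorbs its cost once `k` is large.
  have hnum : ∀ t : ℕ, (t : ℝ) ≤ δ * (β * k) + 2 →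
      Real.exp (-S.logHeight k - ε * k) * (radixProd S.m k * (2 ^ β) ^ t) < 1 := fun t ht => by
    rw [← exp_logHeight]
    have h2 : ((2 : ℝ) ^ β) ^ t = Real.exp (t * (β * Real.log 2)) := by
      rw [Real.exp_nat_mul, Real.exp_nat_mul, Real.exp_log two_pos]
    rw [h2, ← Real.exp_add, ← Real.exp_add, Real.exp_lt_one_iff]
    have h3 := mul_le_mul_of_nonneg_right ht (by positivity : 0 ≤ β * Real.log 2)
    have h4 : (δ * (β * k) + 2) * (β * Real.log 2) = ε / 2 * k + 2 * β * Real.log 2 := by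
      linear_combination (k : ℝ) * hδe
    rw [div_lt_iff₀ (by positivity)] at hkb
    linarith
  have hc : ∀ j : ℕ, (j : ℝ) ≤ β * k → (⌈δ * j⌉₊ : ℝ) ≤ δ * (β * k) + 1 := fun j hj =>
    (Nat.ceil_lt_add_one (by positivity)).le.trans
      (by linarith [mul_le_mul_of_nonneg_left hj hδ0.le])
  have hkk := hc k (le_mul_of_one_le_left k.cast_nonneg hβ0)
  have hll := hc (S.ell k) (by exact_mod_cast ell_le hβ k)
  rw [moranMeasure_closedBall]
  refine (measure_mono (preimage_closedBall_subset hβ (hnum _ (by linarith))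
    (hnum _ (by push_cast; linarith)) (Real.exp_pos _).le hB hT hL hR)).trans ?_
  rw [← ENNReal.ofReal_toReal (measure_ne_top _ (S.approxSquare k w)),
    S.approxSquare_measure p k w hw]
  exact ENNReal.ofReal_le_ofReal (Real.exp_le_exp.2 (by linarith [(abs_le.1 hk).1]))

end MoranConstruction

/-! ### Dimension bounds from bounds on the entropy ratio. -/

theorem eventually_le_mul_natCast {c : ℝ} (hc : 0 < c) (a : ℝ) :
    ∀ᶠ k : ℕ in atTop, a ≤ c * k := by
  filter_upwards [tendsto_natCast_atTop_atTop.eventually_ge_atTop (a / c)] with k hk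
  rwa [div_le_iff₀ hc, mul_comm] at hk

theorem ofReal_exp_rpow (a s : ℝ) :
    ENNReal.ofReal (Real.exp a) ^ s = ENNReal.ofReal (Real.exp (a * s)) := by
  rw [ENNReal.ofReal_rpow_of_pos (Real.exp_pos a), ← Real.exp_mul]

theorem two_mul_exp (a : ℝ) : 2 * Real.exp a = Real.exp (Real.log 2 + a) := by
  rw [Real.exp_add, Real.exp_log two_pos]

namespace MoranConstruction

variable {S : MoranConstruction} (p : S.ProbSeq)

/-- The gap between `s'` and `s` gains `(s - s') k log 2`: half pays for `ε k`, half for the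
constant. The implication inside the filter serves both frequent and eventual bounds; `b` allows for
the ratio of consecutive scales and is `0` when a sequence of scales is enough. -/
theorem eventually_entropy_upper {s' s : ℝ} (hs : s' < s) (b : ℝ) :
    ∃ ε > 0, ∀ᶠ k : ℕ in atTop, S.entropyRatio p k < s' →
      (Real.log 2 + b - S.logHeight k) * s ≤ -S.entropy p k - ε * k := by
  have hc : 0 < (s - s') * Real.log 2 / 2 :=
    half_pos (mul_pos (sub_pos.2 hs) (Real.log_pos one_lt_two))
  refine ⟨(s - s') * Real.log 2 / 2, hc, ?_⟩
  filter_upwards [eventually_le_mul_natCast hc ((Real.log 2 + b) * s), eventually_ge_atTop 1]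
    with k hk hk1 hu
  have hL := S.le_logHeight k
  have hL0 : 0 ≤ S.logHeight k := le_trans (by positivity) hL
  rw [S.entropy_eq p k (by omega)]
  have h1 := mul_le_mul_of_nonneg_right hu.le hL0
  have h2 := mul_le_mul_of_nonneg_left hL (sub_pos.2 hs).le
  linarith

theorem eventually_entropy_lower {s' s : ℝ} (h0 : 0 ≤ s) (hs : s < s') (b : ℝ) :
    ∃ ε > 0, ∀ᶠ k : ℕ in atTop, s' < S.entropyRatio p k →
      -S.entropy p k + ε * k ≤ (-S.logHeight k - b - ε * (k + 1)) * s := by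
  have hc : 0 < (s' - s) * Real.log 2 / 2 :=
    half_pos (mul_pos (sub_pos.2 hs) (Real.log_pos one_lt_two))
  -- The error occurs twice, once in the mass and once, multiplied by `s`, in the radius; hence the
  -- divisor `1 + s`.
  set ε := (s' - s) * Real.log 2 / 2 / (1 + s) with hε
  have hεeq : ε * (1 + s) = (s' - s) * Real.log 2 / 2 := div_mul_cancel₀ _ (by positivity)
  refine ⟨ε, by positivity, ?_⟩
  filter_upwards [eventually_le_mul_natCast hc ((b + ε) * s), eventually_ge_atTop 1]
    with k hk hk1 hu
  have hL := S.le_logHeight k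
  have hL0 : 0 ≤ S.logHeight k := le_trans (by positivity) hL
  rw [S.entropy_eq p k (by omega)]
  have h1 := mul_le_mul_of_nonneg_right hu.le hL0
  have h2 := mul_le_mul_of_nonneg_left hL (sub_pos.2 hs).le
  have h3 : ε * (1 + s) * k = (s' - s) * Real.log 2 / 2 * k := by rw [hεeq]
  linarith

theorem BoundedDigits.exists_logHeight_succ_le (hN : S.BoundedDigits) :
    ∃ b : ℝ, ∀ k, S.logHeight (k + 1) ≤ S.logHeight k + b := by
  obtain ⟨β, -, hβ⟩ := hN.exists_bound
  refine ⟨Real.log (2 ^ β), fun k => ?_⟩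
  rw [logHeight_succ]
  have : 0 < S.m k := two_pos.trans_le (S.two_le_m k)
  have := Real.log_le_log (Nat.cast_pos.2 this) (show (S.m k : ℝ) ≤ 2 ^ β by exact_mod_cast (hβ k).2)
  linarith

theorem tendsto_exp_neg_logHeight :
    Tendsto (fun k => 2 * Real.exp (-S.logHeight k)) atTop (𝓝 0) := by
  simpa using (Real.tendsto_exp_neg_atTop_nhds_zero.comp S.tendsto_logHeight).const_mul 2

theorem tendsto_exp_neg_logHeight_sub {ε : ℝ} (hε : 0 < ε) :
    Tendsto (fun k : ℕ => Real.exp (-S.logHeight k - ε * k)) atTop (𝓝 0) := by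
  refine squeeze_zero (fun k => (Real.exp_pos _).le) (fun k => ?_)
    (Real.tendsto_exp_neg_atTop_nhds_zero.comp S.tendsto_logHeight)
  exact Real.exp_le_exp.2 (by linarith [(by positivity : 0 ≤ ε * (k : ℝ))])

theorem hausdorffDim_moranMeasure_le (hN : S.BoundedDigits) {s' : ℝ} {s : ℝ≥0}
    (hs : s' < s) (hu : ∃ᶠ k in atTop, S.entropyRatio p k < s') :
    (S.moranMeasure p).hausdorffDim ≤ s := by
  obtain ⟨ε, hε, hent⟩ := eventually_entropy_upper p hs 0
  refine hausdorffDim_le_of_ae_frequently _ ?_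
  filter_upwards [ae_eventually_le_measure_closedBall p hN hε] with x hx
  have hlim : Tendsto (fun k => 2 * Real.exp (-S.logHeight k)) atTop (𝓝[>] 0) :=
    tendsto_nhdsWithin_iff.2 ⟨tendsto_exp_neg_logHeight, Eventually.of_forall fun k =>
      mul_pos two_pos (Real.exp_pos _)⟩
  refine hlim.frequently ((hu.and_eventually (hx.and hent)).mono ?_)
  rintro k ⟨h1, h2, h3⟩
  refine le_trans ?_ h2
  rw [two_mul_exp, ofReal_exp_rpow]
  exact ENNReal.ofReal_le_ofReal (Real.exp_le_exp.2 (by linarith [h3 h1]))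

theorem packingDim_moranMeasure_le (hN : S.BoundedDigits) {s' : ℝ} {s : ℝ≥0}
    (hs : s' < s) (hu : ∀ᶠ k in atTop, S.entropyRatio p k < s') :
    (S.moranMeasure p).packingDim ≤ s := by
  obtain ⟨b, hb⟩ := hN.exists_logHeight_succ_le
  obtain ⟨ε, hε, hent⟩ := eventually_entropy_upper p hs b
  refine packingDim_le_of_ae_eventually _ ?_
  filter_upwards [ae_eventually_le_measure_closedBall p hN hε] with x hx
  refine eventually_nhdsGT_of_scales (r := fun k => 2 * Real.exp (-S.logHeight k))
    (fun i j hij => mul_le_mul_of_nonneg_left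
      (Real.exp_le_exp.2 (neg_le_neg (S.logHeight_mono hij))) zero_le_two)
    (fun k => mul_pos two_pos (Real.exp_pos _)) tendsto_exp_neg_logHeight ?_
  -- For `r` between scales `k + 1` and `k`, the mass is bounded below by that of the smaller ball
  -- and `r` above by the larger radius.
  have hshift := tendsto_add_atTop_nat 1
  filter_upwards [hshift.eventually hx, hshift.eventually hent, hshift.eventually hu]
    with k h1 h2 h3 r hr1 hr2
  refine le_trans ?_ (h1.trans (measure_mono (Metric.closedBall_subset_closedBall hr1.le)))
  refine (ENNReal.rpow_le_rpow (ENNReal.ofReal_le_ofReal hr2) s.coe_nonneg).trans ?_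
  rw [two_mul_exp, ofReal_exp_rpow]
  refine ENNReal.ofReal_le_ofReal (Real.exp_le_exp.2 (le_trans ?_ (h2 h3)))
  exact mul_le_mul_of_nonneg_right (by linarith [hb k]) s.coe_nonneg

theorem le_hausdorffDim_moranMeasure (hN : S.BoundedDigits) (hsep : S.BSC ∨ S.MSC p) {s' : ℝ}
    {s : ℝ≥0} (hs : s < s') (hu : ∀ᶠ k in atTop, s' < S.entropyRatio p k) :
    (s : ℝ≥0∞) ≤ (S.moranMeasure p).hausdorffDim := by
  obtain ⟨b, hb⟩ := hN.exists_logHeight_succ_le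
  obtain ⟨ε, hε, hent⟩ := eventually_entropy_lower p s.coe_nonneg hs b
  refine le_hausdorffDim_of_ae_eventually _ ?_
  filter_upwards [ae_eventually_measure_closedBall_le p hN hsep hε] with x hx
  refine eventually_nhdsGT_of_scales (r := fun k : ℕ => Real.exp (-S.logHeight k - ε * k))
    (fun i j hij => Real.exp_le_exp.2 (sub_le_sub (neg_le_neg (S.logHeight_mono hij))
      (mul_le_mul_of_nonneg_left (Nat.cast_le.2 hij) hε.le)))
    (fun k => Real.exp_pos _) (tendsto_exp_neg_logHeight_sub hε) ?_
  filter_upwards [hx, hent, hu] with k h1 h2 h3 r hr1 hr2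
  -- Here the mass is bounded above at scale `k` and the radius below at scale `k + 1`.
  refine (measure_mono (Metric.closedBall_subset_closedBall hr2)).trans (h1.trans ?_)
  refine le_trans ?_ (ENNReal.rpow_le_rpow (ENNReal.ofReal_le_ofReal hr1.le) s.coe_nonneg)
  rw [ofReal_exp_rpow]
  refine ENNReal.ofReal_le_ofReal (Real.exp_le_exp.2 ((h2 h3).trans ?_))
  push_cast
  exact mul_le_mul_of_nonneg_right (by linarith [hb k]) s.coe_nonneg

theorem le_packingDim_moranMeasure (hN : S.BoundedDigits) (hsep : S.BSC ∨ S.MSC p) {s' : ℝ}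
    {s : ℝ≥0} (hs : s < s') (hu : ∃ᶠ k in atTop, s' < S.entropyRatio p k) :
    (s : ℝ≥0∞) ≤ (S.moranMeasure p).packingDim := by
  obtain ⟨ε, hε, hent⟩ := eventually_entropy_lower p s.coe_nonneg hs 0
  refine le_packingDim_of_ae_frequently _ ?_
  filter_upwards [ae_eventually_measure_closedBall_le p hN hsep hε] with x hx
  have hlim : Tendsto (fun k : ℕ => Real.exp (-S.logHeight k - ε * k)) atTop (𝓝[>] 0) :=
    tendsto_nhdsWithin_iff.2 ⟨tendsto_exp_neg_logHeight_sub hε, Eventually.of_forall fun k =>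
      Real.exp_pos _⟩
  refine hlim.frequently ((hu.and_eventually (hx.and hent)).mono ?_)
  rintro k ⟨h1, h2, h3⟩
  refine h2.trans ?_
  rw [ofReal_exp_rpow]
  refine ENNReal.ofReal_le_ofReal (Real.exp_le_exp.2 ((h3 h1).trans ?_))
  exact mul_le_mul_of_nonneg_right (by linarith) s.coe_nonneg

end MoranConstruction

/-! ### Conclusion. -/

/-- Inserting a real `s'` between the limit and the candidate dimension `s` supplies the strict
slack that the entropy estimates consume. -/
theorem EReal.coe_ennreal_eq_of_forall_real {d : ℝ≥0∞} {x : EReal} (hx : 0 ≤ x)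
    (hle : ∀ (s' : ℝ) (s : ℝ≥0), x < s' → s' < s → d ≤ s)
    (hge : ∀ (s' : ℝ) (s : ℝ≥0), (s' : EReal) < x → s < s' → s ≤ d) : (d : EReal) = x := by
  refine le_antisymm (EReal.le_of_forall_lt_iff_le.1 fun z hz => ?_)
    (EReal.ge_of_forall_gt_iff_ge.1 fun z hz => ?_)
  · obtain ⟨s', h1, h2⟩ := EReal.lt_iff_exists_real_btwn.1 hz
    lift z to ℝ≥0 using EReal.coe_nonneg.1 (hx.trans hz.le)
    exact EReal.coe_ennreal_le_coe_ennreal_iff.2 (hle s' z h1 (EReal.coe_lt_coe_iff.1 h2))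
  · rcases lt_or_ge z 0 with h0 | h0
    · exact (EReal.coe_nonpos.2 h0.le).trans (EReal.coe_ennreal_nonneg d)
    obtain ⟨s', h1, h2⟩ := EReal.lt_iff_exists_real_btwn.1 hz
    lift z to ℝ≥0 using h0
    exact EReal.coe_ennreal_le_coe_ennreal_iff.2 (hge s' z h2 (EReal.coe_lt_coe_iff.1 h1))

/-- Hausdorff and packing dimensions of a self-affine Moran measure. -/
theorem theorem4p1 (S : MoranConstruction) (hN : S.BoundedDigits) (p : S.ProbSeq)
    (hsep : S.BSC ∨ S.MSC p) :
    (((S.moranMeasure p).hausdorffDim : ℝ≥0∞) : EReal) =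
        liminf (fun k : ℕ => ((S.entropyRatio p k : ℝ) : EReal)) atTop ∧
      (((S.moranMeasure p).packingDim : ℝ≥0∞) : EReal) =
        limsup (fun k : ℕ => ((S.entropyRatio p k : ℝ) : EReal)) atTop := by
  have h0 : 0 ≤ liminf (fun k : ℕ => ((S.entropyRatio p k : ℝ) : EReal)) atTop :=
    le_liminf_of_le (by isBoundedDefault)
      (Eventually.of_forall fun k => EReal.coe_nonneg.2 (S.entropyRatio_nonneg p k))
  constructor
  · refine EReal.coe_ennreal_eq_of_forall_real h0 (fun s' s hs' hs => ?_) fun s' s hs' hs => ?_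
    · exact MoranConstruction.hausdorffDim_moranMeasure_le p hN hs
        ((frequently_lt_of_liminf_lt (by isBoundedDefault) hs').mono fun k hk =>
          EReal.coe_lt_coe_iff.1 hk)
    · exact MoranConstruction.le_hausdorffDim_moranMeasure p hN hsep hs
        ((eventually_lt_of_lt_liminf hs').mono fun k hk => EReal.coe_lt_coe_iff.1 hk)
  · refine EReal.coe_ennreal_eq_of_forall_real (h0.trans (liminf_le_limsup))
      (fun s' s hs' hs => ?_) fun s' s hs' hs => ?_
    · exact MoranConstruction.packingDim_moranMeasure_le p hN hs
        ((eventually_lt_of_limsup_lt hs').mono fun k hk => EReal.coe_lt_coe_iff.1 hk)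
    · exact MoranConstruction.le_packingDim_moranMeasure p hN hsep hs
        ((frequently_lt_of_lt_limsup (by isBoundedDefault) hs').mono fun k hk =>
          EReal.coe_lt_coe_iff.1 hk)
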